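/- Let $f\in C^2(\mathbb R)$ and let $F$ be an antiderivative of $f$. Let $\Omega\subset\mathbb R^3$ be open and, for $(a,E,c)\in\Omega$, let $u(\cdot\,;a,E,c)$ be a nonconstant periodic $C^2$ solution of $$u_{xx}=a+cu-f(u),\qquad \tfrac12u_x^2=E+au+\tfrac c2u^2-F(u),$$ (a traveling wave profile of $u_t+u_{xxx}+f(u)_x=0$ with speed $c$), such that $u$ is jointly $C^1$ in $(x,a,E,c)$ on $\mathbb R\times\Omega$. Let $T(a,E,c)$ be the fundamental period of $u$, $M=\int_0^Tu\,dx$ and $P=\int_0^Tu^2\,dx$. Subscripts $a,E,c$ denote partial derivatives, and $$\{G,H\}_{a,E}=\begin{vmatrix}G_a&G_E\\H_a&H_E\end{vmatrix},$$ similarly for $3\times3$ Jacobians. Then $T,M,P$ are differentiable on $\Omega$. Fix $(a,E,c)\in\Omega$ and an integer $k\ge1$, let $\mathcal L=-\partial_x^2-f'(u)+c$, and consider the unbounded operators $\mathcal L$ (domain $H^2$), $\partial_x\mathcal L$ and $\mathcal L\partial_x$ on the real space $L^2(\mathbb R/kT\mathbb Z)$. For an operator $A$ put $\mathrm{g\text{-}ker}_j(A)=\ker(A^{j+1})/\ker(A^j)$.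 Let $$\phi_1=\begin{vmatrix}u_E&T_E\\u_a&T_a\end{vmatrix},\qquad \phi_2=\begin{vmatrix}u_E&T_E&M_E\\u_a&T_a&M_a\\u_c&T_c&M_c\end{vmatrix}.$$ 0. If $T_E\ne0$, $\{T,M\}_{a,E}\neq0$ and $\{T,M,P\}_{a,E,c}\ne0$, then $\dim\ker\mathcal L=1$, $\dim\ker\partial_x\mathcal L=2$, $\dim\mathrm{g\text{-}ker}_1(\partial_x\mathcal L)=1$, and $\mathrm{g\text{-}ker}_j(\partial_x\mathcal L)=0$ for $j\ge2$. 1. If $T_E\neq0$, then $\ker\mathcal L=\mathrm{span}\{u_x\}$; if $T_E=0$, then $\ker\mathcal L=\mathrm{span}\{u_x,u_E\}$. 2. If $T_E,T_a$ are not both $0$, then $\ker\partial_x\mathcal L=\mathrm{span}\{u_x,\phi_1\}$ and $\ker\mathcal L\partial_x=\mathrm{span}\{1,u\}$. 3. If $T_E=T_a=0$, then $\ker\partial_x\mathcal L=\mathrm{span}\{u_x,u_a,u_E\}$ and $\ker\mathcal L\partial_x=\mathrm{span}\{1,u,\int_0^xu_E\,dx\}$. In every case both kernels have dimension at most $3$.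 4. If $\{T,M\}_{a,E}\neq0$, then $\mathrm{g\text{-}ker}_1(\partial_x\mathcal L)$ is spanned by (the class of) $\phi_2$, and $\mathrm{g\text{-}ker}_1(\mathcal L\partial_x)$ is spanned by (the class of) $\int_0^x\phi_2\,dx$. If $\{T,M\}_{a,E}$ and $\{T,P\}_{a,E}$ are not both $0$, then $\mathrm{g\text{-}ker}_1(\partial_x\mathcal L)$ and $\mathrm{g\text{-}ker}_1(\mathcal L\partial_x)$ are one-dimensional. 5. If $\{T,M\}_{a,E}\neq0$ and $\{T,M,P\}_{E,a,c}\ne0$, then $\mathrm{g\text{-}ker}_j(\partial_x\mathcal L)=0$ and $\mathrm{g\text{-}ker}_j(\mathcal L\partial_x)=0$ for all $j\ge2$. -/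

import Mathlib

open MeasureTheory

noncomputable section

namespace KdV

/-! ### Parameters and partial derivatives

A parameter point is a triple `(a, E, c)`. -/

/-- The parameter space of triples `(a, E, c)`. -/
abbrev Param : Type := ℝ × ℝ × ℝ

/-- The coordinate direction of `a`. -/
def dirA : Param := (1, 0, 0)
/-- The coordinate direction of `E`. -/
def dirE : Param := (0, 1, 0)
/-- The coordinate direction of `c`. -/
def dirC : Param := (0, 0, 1)

/-- The Jacobian `{G, H}_{v, w}` at `p`, where `v, w` are coordinate directions. -/
def jac2 (G H : Param → ℝ) (v w : Param) (p : Param) : ℝ :=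
  Matrix.det !![lineDeriv ℝ G p v, lineDeriv ℝ G p w;
                lineDeriv ℝ H p v, lineDeriv ℝ H p w]

/-- The Jacobian `{G, H, K}_{v, w, z}` at `p`, where `v, w, z` are coordinate directions. -/
def jac3 (G H K : Param → ℝ) (v w z : Param) (p : Param) : ℝ :=
  Matrix.det !![lineDeriv ℝ G p v, lineDeriv ℝ G p w, lineDeriv ℝ G p z;
                lineDeriv ℝ H p v, lineDeriv ℝ H p w, lineDeriv ℝ H p z;
                lineDeriv ℝ K p v, lineDeriv ℝ K p w, lineDeriv ℝ K p z]

/-! ### Families of periodic traveling waves -/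

/-- `u (a, E, c) x` is a continuously differentiable family, over an open set `Ω` of parameters, of
nonconstant periodic traveling wave profiles of `u_t + u_xxx + f(u)_x = 0` with wave speed `c` and
constants of integration `a`, `E`. The translation of each profile is arbitrary. -/
structure IsPeriodicWaveFamily (f F : ℝ → ℝ) (Ω : Set Param) (u : Param → ℝ → ℝ) : Prop where
  isOpen : IsOpen Ω
  contDiffOn : ContDiffOn ℝ 1 (fun z : Param × ℝ => u z.1 z.2) (Ω ×ˢ Set.univ)
  contDiff : ∀ p ∈ Ω, ContDiff ℝ 2 (u p)
  /-- `u_xx = a + c u - f(u)` -/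
  profile : ∀ p ∈ Ω, ∀ x, deriv (deriv (u p)) x = p.1 + p.2.2 * u p x - f (u p x)
  /-- `u_x² / 2 = E + a u + c u² / 2 - F(u)` -/
  energy : ∀ p ∈ Ω, ∀ x,
    deriv (u p) x ^ 2 / 2 = p.2.1 + p.1 * u p x + p.2.2 * u p x ^ 2 / 2 - F (u p x)
  periodic : ∀ p ∈ Ω, ∃ t, 0 < t ∧ Function.Periodic (u p) t
  nonconstant : ∀ p ∈ Ω, ∃ x y, u p x ≠ u p y

/-- The (fundamental) period `T(a, E, c)`. -/
def period (u : Param → ℝ → ℝ) (p : Param) : ℝ := sInf {t | 0 < t ∧ Function.Periodic (u p) t}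

/-- The mass `M(a, E, c)`. -/
def mass (u : Param → ℝ → ℝ) (p : Param) : ℝ := ∫ x in (0 : ℝ)..period u p, u p x

/-- The momentum `P(a, E, c)`. -/
def momentum (u : Param → ℝ → ℝ) (p : Param) : ℝ := ∫ x in (0 : ℝ)..period u p, u p x ^ 2

/-- The derivative of the profile in the parameter direction `v`, as a function of `x`:
`u_a`, `u_E`, `u_c` for `v = dirA, dirE, dirC`. -/
def uParam (u : Param → ℝ → ℝ) (v : Param) (p : Param) (x : ℝ) : ℝ := lineDeriv ℝ (fun q => u q x) p v

/-- `| u_E T_E ; u_a T_a |` -/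
def phi1 (u : Param → ℝ → ℝ) (p : Param) (x : ℝ) : ℝ :=
  Matrix.det !![uParam u dirE p x, lineDeriv ℝ (period u) p dirE;
                uParam u dirA p x, lineDeriv ℝ (period u) p dirA]

/-- `| u_E T_E M_E ; u_a T_a M_a ; u_c T_c M_c |` -/
def phi2 (u : Param → ℝ → ℝ) (p : Param) (x : ℝ) : ℝ :=
  Matrix.det
    !![uParam u dirE p x, lineDeriv ℝ (period u) p dirE, lineDeriv ℝ (mass u) p dirE;
       uParam u dirA p x, lineDeriv ℝ (period u) p dirA, lineDeriv ℝ (mass u) p dirA;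
       uParam u dirC p x, lineDeriv ℝ (period u) p dirC, lineDeriv ℝ (mass u) p dirC]

/-! ### Operators on the space of square integrable periodic functions

An element of `L²(ℝ/ℓℤ)` is represented by its restriction to the fundamental domain `(0, ℓ]`.
An unbounded operator is represented by its graph. -/

/-- `L²(ℝ/ℓℤ)`, real-valued. -/
abbrev L2per (ℓ : ℝ) : Type := Lp ℝ 2 (volume.restrict (Set.Ioc 0 ℓ))

open Classical in
/-- The class in `L²(ℝ/ℓℤ)` of an `ℓ`-periodic (locally square integrable) function. -/
def toL2per (ℓ : ℝ) (g : ℝ → ℝ) : L2per ℓ :=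
  if h : MemLp g 2 (volume.restrict (Set.Ioc 0 ℓ)) then h.toLp g else 0

theorem L2per.intervalIntegrable {ℓ : ℝ} (w : L2per ℓ) {x : ℝ} (hx : x ∈ Set.Icc 0 ℓ) :
    IntervalIntegrable w volume 0 x := by
  rw [intervalIntegrable_iff_integrableOn_Ioc_of_le hx.1]
  have h : IntegrableOn w (Set.Ioc 0 ℓ) volume := (Lp.memLp w).integrable (by norm_num)
  exact h.mono_set (Set.Ioc_subset_Ioc_right hx.2)

/-- The graph of `∂ₓ` on `L²(ℝ/ℓℤ)`, with domain `H¹(ℝ/ℓℤ)`: the pairs `(v, w)` such that `v` has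
an absolutely continuous representative `g` with the same value at `0` and `ℓ` and with `g' = w`
almost everywhere. -/
def derivOp (ℓ : ℝ) : Submodule ℝ (L2per ℓ × L2per ℓ) where
  carrier := {z | ∃ g : ℝ → ℝ, z.1 =ᵐ[volume.restrict (Set.Ioc 0 ℓ)] g ∧ g ℓ = g 0 ∧
    ∀ x ∈ Set.Icc 0 ℓ, g x = g 0 + ∫ t in (0 : ℝ)..x, z.2 t}
  zero_mem' := by
    refine ⟨0, Lp.coeFn_zero _ _ _, rfl, fun x hx => ?_⟩
    have h : ∫ t in (0 : ℝ)..x, (0 : L2per ℓ) t = ∫ t in (0 : ℝ)..x, (0 : ℝ) := by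
      rw [intervalIntegral.integral_of_le hx.1, intervalIntegral.integral_of_le hx.1]
      refine integral_congr_ae (ae_restrict_of_ae_restrict_of_subset
        (Set.Ioc_subset_Ioc_right hx.2) ?_)
      exact Lp.coeFn_zero _ _ _
    rw [show (0 : L2per ℓ × L2per ℓ).2 = 0 from rfl, h]
    simp
  add_mem' := by
    rintro z z' ⟨g, hg, hp, hi⟩ ⟨g', hg', hp', hi'⟩
    refine ⟨g + g', (Lp.coeFn_add _ _).trans (hg.add hg'), by simp [hp, hp'], fun x hx => ?_⟩
    have h : ∫ t in (0 : ℝ)..x, (z + z').2 t = ∫ t in (0 : ℝ)..x, (z.2 t + z'.2 t) := by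
      rw [intervalIntegral.integral_of_le hx.1, intervalIntegral.integral_of_le hx.1]
      refine integral_congr_ae (ae_restrict_of_ae_restrict_of_subset
        (Set.Ioc_subset_Ioc_right hx.2) ?_)
      exact Lp.coeFn_add _ _
    rw [h, intervalIntegral.integral_add (z.2.intervalIntegrable hx) (z'.2.intervalIntegrable hx),
      Pi.add_apply, Pi.add_apply, hi x hx, hi' x hx]
    ring
  smul_mem' := by
    rintro r z ⟨g, hg, hp, hi⟩
    refine ⟨r • g, (Lp.coeFn_smul _ _).trans (hg.const_smul r), by simp [hp], fun x hx => ?_⟩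
    have h : ∫ t in (0 : ℝ)..x, (r • z).2 t = ∫ t in (0 : ℝ)..x, r * z.2 t := by
      rw [intervalIntegral.integral_of_le hx.1, intervalIntegral.integral_of_le hx.1]
      refine integral_congr_ae (ae_restrict_of_ae_restrict_of_subset
        (Set.Ioc_subset_Ioc_right hx.2) ?_)
      exact Lp.coeFn_smul _ _
    rw [h, intervalIntegral.integral_const_mul, Pi.smul_apply, Pi.smul_apply, hi x hx]
    simp only [smul_eq_mul]
    ring

/-- `∂ₓ` is single-valued. -/
theorem derivOp_unique {ℓ : ℝ} (hℓ : 0 < ℓ) {v w w' : L2per ℓ} (h : (v, w) ∈ derivOp ℓ)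
    (h' : (v, w') ∈ derivOp ℓ) : w = w' := by
  have hz : (0, w - w') ∈ derivOp ℓ := by simpa using sub_mem h h'
  obtain ⟨g, hg, hp, hi⟩ := hz
  set z := w - w' with hzdef
  have hint : IntervalIntegrable z volume 0 ℓ := z.intervalIntegrable ⟨hℓ.le, le_rfl⟩
  have hcont : ContinuousOn g (Set.Icc 0 ℓ) := by
    have hc : ContinuousOn (fun x => g 0 + ∫ t in (0 : ℝ)..x, z t) (Set.Icc 0 ℓ) := by
      refine continuousOn_const.add ?_
      have := intervalIntegral.continuousOn_primitive_interval
        (f := z) (μ := volume) (a := 0) (b := ℓ) (by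
          rw [Set.uIcc_of_le hℓ.le, integrableOn_Icc_iff_integrableOn_Ioc]
          exact (intervalIntegrable_iff_integrableOn_Ioc_of_le hℓ.le).1 hint)
      rwa [Set.uIcc_of_le hℓ.le] at this
    exact hc.congr hi
  have h0 : (0 : ℝ → ℝ) =ᵐ[volume.restrict (Set.Ioc 0 ℓ)] g :=
    (Lp.coeFn_zero _ _ _).symm.trans hg
  have hg0 : Set.EqOn (0 : ℝ → ℝ) g (Set.Ioc 0 ℓ) :=
    Measure.eqOn_Ioc_of_ae_eq (μ := volume) h0 continuousOn_const
      (hcont.mono Set.Ioc_subset_Icc_self)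
  have hgl : g 0 = 0 := by rw [← hp]; exact (hg0 ⟨hℓ, le_rfl⟩).symm
  have hprim : ∀ x ∈ Set.Icc 0 ℓ, ∫ t in (0 : ℝ)..x, z t = 0 := by
    intro x hx
    have h1 := hi x hx
    rcases eq_or_lt_of_le hx.1 with rfl | hx0
    · simp
    · have h2 := hg0 ⟨hx0, hx.2⟩
      simp only [Pi.zero_apply] at h2
      linarith
  have hzero : z =ᵐ[volume.restrict (Set.Ioc 0 ℓ)] (0 : ℝ → ℝ) := by
    have hd := hint.ae_hasDerivAt_integral
    rw [Filter.EventuallyEq, ae_restrict_iff' measurableSet_Ioc]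
    have hne : ∀ᵐ x : ℝ, x ≠ ℓ := compl_mem_ae_iff.2 (measure_singleton ℓ)
    filter_upwards [hd, hne] with x hx hxl hx''
    have hx' : x ∈ Set.Ioo 0 ℓ := ⟨hx''.1, lt_of_le_of_ne hx''.2 hxl⟩
    have hxm : x ∈ Set.uIcc 0 ℓ := by
      rw [Set.uIcc_of_le hℓ.le]; exact Set.Ioo_subset_Icc_self hx'
    have h1 := hx hxm 0 Set.left_mem_uIcc
    have h2 : HasDerivAt (fun y => ∫ t in (0 : ℝ)..y, z t) 0 x := by
      refine (hasDerivAt_const x (0 : ℝ)).congr_of_eventuallyEq ?_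
      filter_upwards [Ioo_mem_nhds hx'.1 hx'.2] with y hy
      exact hprim y (Set.Ioo_subset_Icc_self hy)
    exact h1.unique h2
  exact sub_eq_zero.1 (Lp.ext (hzero.trans (Lp.coeFn_zero _ _ _).symm))

/-- The graph of `-∂ₓ² - W + c` on `L²(ℝ/ℓℤ)`, with domain `H²(ℝ/ℓℤ)` if `W` is bounded. -/
def schrodingerOp (ℓ : ℝ) (W : ℝ → ℝ) (c : ℝ) : Submodule ℝ (L2per ℓ × L2per ℓ) where
  carrier := {z | ∃ v₁ v₂ : L2per ℓ, (z.1, v₁) ∈ derivOp ℓ ∧ (v₁, v₂) ∈ derivOp ℓ ∧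
    z.2 =ᵐ[volume.restrict (Set.Ioc 0 ℓ)] fun x => -v₂ x - W x * z.1 x + c * z.1 x}
  zero_mem' := by
    refine ⟨0, 0, zero_mem _, zero_mem _, ?_⟩
    filter_upwards [Lp.coeFn_zero ℝ 2 (volume.restrict (Set.Ioc 0 ℓ))] with x hx
    simp only [Prod.fst_zero, Prod.snd_zero, hx, Pi.zero_apply]
    ring
  add_mem' := by
    rintro z z' ⟨v₁, v₂, h₁, h₂, h⟩ ⟨v₁', v₂', h₁', h₂', h'⟩
    refine ⟨v₁ + v₁', v₂ + v₂', add_mem h₁ h₁', add_mem h₂ h₂', ?_⟩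
    filter_upwards [h, h', Lp.coeFn_add z.1 z'.1, Lp.coeFn_add z.2 z'.2, Lp.coeFn_add v₂ v₂']
      with x e e' e₁ e₂ e₃
    simp only [Prod.fst_add, Prod.snd_add, e₁, e₂, e₃, Pi.add_apply, e, e']
    ring
  smul_mem' := by
    rintro r z ⟨v₁, v₂, h₁, h₂, h⟩
    refine ⟨r • v₁, r • v₂, (derivOp ℓ).smul_mem r h₁, (derivOp ℓ).smul_mem r h₂, ?_⟩
    filter_upwards [h, Lp.coeFn_smul r z.1, Lp.coeFn_smul r z.2, Lp.coeFn_smul r v₂]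
      with x e e₁ e₂ e₃
    simp only [Prod.smul_fst, Prod.smul_snd, e₁, e₂, e₃, Pi.smul_apply, e, smul_eq_mul]
    ring

section Operators

variable {V : Type*} [AddCommGroup V] [Module ℝ V]

/-- The graph of the composition `B ∘ A` of unbounded operators, with its natural domain
`{v ∈ D(A) | A v ∈ D(B)}`. -/
def compOp (B A : Submodule ℝ (V × V)) : Submodule ℝ (V × V) where
  carrier := {z | ∃ w, (z.1, w) ∈ A ∧ (w, z.2) ∈ B}
  zero_mem' := ⟨0, A.zero_mem, B.zero_mem⟩
  add_mem' := by
    rintro z z' ⟨w, h₁, h₂⟩ ⟨w', h₁', h₂'⟩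
    exact ⟨w + w', A.add_mem h₁ h₁', B.add_mem h₂ h₂'⟩
  smul_mem' := by
    rintro r z ⟨w, h₁, h₂⟩
    exact ⟨r • w, A.smul_mem r h₁, B.smul_mem r h₂⟩

/-- `ker (A ^ n)`: it is `0` for `n = 0`, and `v ∈ ker (A ^ (n + 1))` if and only if `v ∈ D(A)` and
`A v ∈ ker (A ^ n)`. -/
def kerPow (A : Submodule ℝ (V × V)) : ℕ → Submodule ℝ V
  | 0 => ⊥
  | n + 1 => (A ⊓ (kerPow A n).comap (LinearMap.snd ℝ V V)).map (LinearMap.fst ℝ V V)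

/-- `ker A` -/
def opKer (A : Submodule ℝ (V × V)) : Submodule ℝ V := kerPow A 1

/-- The generalized kernel `ker (A ^ (n + 1)) / ker (A ^ n)`. -/
abbrev gker (A : Submodule ℝ (V × V)) (n : ℕ) : Type _ :=
  kerPow A (n + 1) ⧸ (kerPow A n).submoduleOf (kerPow A (n + 1))

/-- The generalized kernel `ker (A ^ (n + 1)) / ker (A ^ n)` is spanned by the class of `v`
(in particular `v ∈ ker (A ^ (n + 1))`). -/
def GkerSpannedBy (A : Submodule ℝ (V × V)) (n : ℕ) (v : V) : Prop :=
  ∃ h : v ∈ kerPow A (n + 1),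
    Submodule.span ℝ {((kerPow A n).submoduleOf (kerPow A (n + 1))).mkQ ⟨v, h⟩} = ⊤

end Operators

/-- `𝓛 = -∂ₓ² - f'(u) + c` on `L²(ℝ/kTℤ)`. -/
def opL (u : Param → ℝ → ℝ) (f : ℝ → ℝ) (p : Param) (k : ℕ) :
    Submodule ℝ (L2per (k * period u p) × L2per (k * period u p)) :=
  schrodingerOp (k * period u p) (fun x => deriv f (u p x)) p.2.2

/-- `∂ₓ𝓛` on `L²(ℝ/kTℤ)`. -/
def opDL (u : Param → ℝ → ℝ) (f : ℝ → ℝ) (p : Param) (k : ℕ) :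
    Submodule ℝ (L2per (k * period u p) × L2per (k * period u p)) :=
  compOp (derivOp (k * period u p)) (opL u f p k)

/-- `𝓛∂ₓ` on `L²(ℝ/kTℤ)`. -/
def opLD (u : Param → ℝ → ℝ) (f : ℝ → ℝ) (p : Param) (k : ℕ) :
    Submodule ℝ (L2per (k * period u p) × L2per (k * period u p)) :=
  compOp (opL u f p k) (derivOp (k * period u p))

/-- The class of a function in `L²(ℝ/kTℤ)`. -/
abbrev cls (u : Param → ℝ → ℝ) (p : Param) (k : ℕ) (g : ℝ → ℝ) : L2per (k * period u p) :=
  toL2per (k * period u p) g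

end KdV

end

/-!
# Kernels of the linearized operators at periodic traveling waves

For a direction `v` in the parameter space let `u_v` be the derivative of the profile in that
direction. Differentiating the profile equation gives `𝓛 u_v = -(v_a + v_c u)`, and differentiating
the energy identity shows that the Wronskian of `u_x` and `u_v` is `v_E + v_a u + v_c u² / 2`
(`hasDerivAt_deriv_uParam`, `wronskian_uParam`). In particular `u_x` and `u_E` form a fundamental
system for `𝓛` with Wronskian `1`, so that every solution on `[0, kT]` of `𝓛 w = C + A u` is of the
form `α u_x + u_v` with `v_a = -C`, `v_c = -A`. Differentiating `u(x + T) = u(x)` gives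
`u_v(x + T) = u_v(x) - T_v u_x(x)`. The solution is therefore `kT`-periodic exactly if `T_v = 0`
(`mem_opL_iff`). Moreover, `∫₀ᵀ u_v = M_v` and `∫₀ᵀ u u_v = P_v / 2` when `T_v = 0`.

All kernels thus become linear conditions on `v`. An element `α u_x + u_v` with `T_v = 0` lies in
the range of `∂ₓ` only if its mean vanishes, that is `M_v = 0` (`mem_derivOp_mode_iff`), and its
primitive lies in the range of `𝓛` only if it is orthogonal to `u_x`, that is `P_v = 0`
(`momentum_stationary_of_mem_opL`). The Jacobians `{T, M}`, `{T, P}` and `{T, M, P}` decide whether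
these conditions force `v = 0`. The relations `M_E = T_a`, `P_E = 2 T_c` and `P_a = 2 M_c`
(`action_hessian_symm`), which follow from Green's identity, connect the conditions for `∂ₓ𝓛` with
those for `𝓛∂ₓ`.

Two analytic points underlie this. First, `u_x` is differentiable in the parameters, although only
`u` is assumed to be jointly `C¹`, because Taylor's formula expresses it through `u` and
`u_xx = a + c u - f(u)` (`taylor_uParam`). Second, the fundamental period is differentiable
(`differentiableAt_period`): the implicit function theorem continues it to nearby parameters as a
period, and compactness shows that this period remains the least one.
-/

namespace KdV

open Filter Topology

/-! ### Calculus preliminaries -/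

/-- A continuous nonconstant periodic function has a least positive period, and all its positive
periods are multiples of that one: its periods form a closed subgroup of `ℝ`. -/
theorem exists_isLeast_period {g : ℝ → ℝ} (hg : Continuous g)
    (hper : ∃ t, 0 < t ∧ Function.Periodic g t) (hne : ∃ x y, g x ≠ g y) :
    ∃ T, IsLeast {t | 0 < t ∧ Function.Periodic g t} T ∧
      ∀ t, 0 < t → Function.Periodic g t → ∃ n : ℕ, 1 ≤ n ∧ t = n * T := by
  let S : AddSubgroup ℝ :=
    { carrier := {t | Function.Periodic g t}
      zero_mem' := fun x => by simp
      add_mem' := fun ha hb => ha.add_period hb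
      neg_mem' := fun ha => ha.neg }
  have hmem : ∀ t, t ∈ S ↔ Function.Periodic g t := fun t => Iff.rfl
  rcases S.dense_or_cyclic with hd | ⟨a, ha⟩
  · exfalso
    obtain ⟨x, y, hxy⟩ := hne
    have hcl : IsClosed (S : Set ℝ) := by
      have : (S : Set ℝ) = ⋂ x, {t | g (x + t) = g x} := by
        ext t
        simp only [Set.mem_iInter]
        exact Iff.rfl
      rw [this]
      exact isClosed_iInter fun x => isClosed_eq (by fun_prop) continuous_const
    have huniv : (S : Set ℝ) = Set.univ := by rw [← hcl.closure_eq, hd.closure_eq]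
    have hyx : Function.Periodic g (y - x) := by
      rw [← hmem, ← SetLike.mem_coe, huniv]; trivial
    exact hxy (by simpa using (hyx x).symm)
  · have hz : ∀ t, Function.Periodic g t ↔ ∃ n : ℤ, n * a = t := by
      intro t
      rw [← hmem, ha, AddSubgroup.mem_closure_singleton]
      simp
    obtain ⟨t₀, ht₀, hp₀⟩ := hper
    have ha0 : a ≠ 0 := by
      rintro rfl
      obtain ⟨n, hn⟩ := (hz t₀).1 hp₀
      simp at hn; linarith
    have hmult : ∀ t, 0 < t → Function.Periodic g t → ∃ n : ℕ, 1 ≤ n ∧ t = n * |a| := by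
      intro t ht hpt
      obtain ⟨n, hn⟩ := (hz t).1 hpt
      refine ⟨n.natAbs, ?_, ?_⟩
      · rw [Nat.one_le_iff_ne_zero, Int.natAbs_ne_zero]
        rintro rfl
        simp at hn; linarith
      · rw [Nat.cast_natAbs, Int.cast_abs, ← abs_mul, hn, abs_of_pos ht]
    refine ⟨|a|, ⟨⟨abs_pos.2 ha0, ?_⟩, ?_⟩, hmult⟩
    · have : Function.Periodic g a := (hz a).2 ⟨1, by simp⟩
      rcases abs_choice a with h | h <;> rw [h]
      · exact this
      · exact this.neg
    · rintro t ⟨ht, hpt⟩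
      obtain ⟨n, hn, rfl⟩ := hmult t ht hpt
      have : (1 : ℝ) ≤ n := by exact_mod_cast hn
      nlinarith [abs_nonneg a]

theorem hasDerivAt_taylor_integral {G : ℝ → ℝ} (hG : Continuous G) (A b x₀ x : ℝ) :
    HasDerivAt (fun x => A + (x - x₀) * b + ∫ s in x₀..x, (x - s) * G s)
      (b + ∫ s in x₀..x, G s) x := by
  have h : (fun x => A + (x - x₀) * b + ∫ s in x₀..x, (x - s) * G s) =
      fun x => A + (x - x₀) * b + (x * (∫ s in x₀..x, G s) - ∫ s in x₀..x, s * G s) := by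
    funext y
    rw [← intervalIntegral.integral_const_mul, ← intervalIntegral.integral_sub
      ((by fun_prop : Continuous fun s => y * G s).intervalIntegrable _ _)
      ((by fun_prop : Continuous fun s => s * G s).intervalIntegrable _ _)]
    simp only [sub_mul]
  rw [h]
  have h1 : HasDerivAt (fun x => ∫ s in x₀..x, G s) (G x) x :=
    (hG.integral_hasStrictDerivAt x₀ x).hasDerivAt
  have h2 : HasDerivAt (fun x => ∫ s in x₀..x, s * G s) (x * G x) x :=
    (by fun_prop : Continuous fun s => s * G s).integral_hasStrictDerivAt x₀ x |>.hasDerivAt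
  have h3 := ((((hasDerivAt_id x).sub_const x₀).mul_const b).const_add A).add
    (((hasDerivAt_id x).mul h1).sub h2)
  refine h3.congr_deriv ?_
  simp

/-- Taylor's formula of second order with integral remainder. -/
theorem taylor_integral {y y' G : ℝ → ℝ} (hG : Continuous G) (hy : ∀ x, HasDerivAt y (y' x) x)
    (hy' : ∀ x, HasDerivAt y' (G x) x) (x₀ x : ℝ) :
    y x = y x₀ + (x - x₀) * y' x₀ + ∫ s in x₀..x, (x - s) * G s := by
  have hd : ∀ z, HasDerivAt (fun x => y x -
      (y x₀ + (x - x₀) * y' x₀ + ∫ s in x₀..x, (x - s) * G s)) 0 z := by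
    intro z
    refine ((hy z).sub (hasDerivAt_taylor_integral hG (y x₀) (y' x₀) x₀ z)).congr_deriv ?_
    rw [intervalIntegral.integral_eq_sub_of_hasDerivAt (fun s _ => hy' s)
      (hG.intervalIntegrable _ _)]
    ring
  have := is_const_of_deriv_eq_zero (fun z => (hd z).differentiableAt) (fun z => (hd z).deriv) x x₀
  simp at this
  linarith

/-- The partial derivative in the first variable, in terms of the total derivative. -/
theorem hasFDerivAt_section_left {E : Type*} [NormedAddCommGroup E] [NormedSpace ℝ E]
    {h : E → ℝ → ℝ} {p : E} {x : ℝ} (hh : DifferentiableAt ℝ (fun z : E × ℝ => h z.1 z.2) (p, x)) :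
    HasFDerivAt (fun q => h q x) ((fderiv ℝ (fun z : E × ℝ => h z.1 z.2) (p, x)).comp
      (ContinuousLinearMap.inl ℝ E ℝ)) p :=
  HasFDerivAt.comp (f := fun e => (e, x)) (g := fun z : E × ℝ => h z.1 z.2) p hh.hasFDerivAt
    (hasFDerivAt_prodMk_left p x)

/-- Differentiation under the integral sign for a family which is jointly `C¹`. -/
theorem hasFDerivAt_integral_of_contDiffOn {E : Type*} [NormedAddCommGroup E] [NormedSpace ℝ E]
    {Ω : Set E} (hΩ : IsOpen Ω) {h : E → ℝ → ℝ}
    (hh : ContDiffOn ℝ 1 (fun z : E × ℝ => h z.1 z.2) (Ω ×ˢ Set.univ)) {p : E} (hp : p ∈ Ω)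
    (a b : ℝ) :
    HasFDerivAt (fun q => ∫ x in a..b, h q x)
      (∫ x in a..b, (fderiv ℝ (fun z : E × ℝ => h z.1 z.2) (p, x)).comp
        (ContinuousLinearMap.inl ℝ E ℝ)) p := by
  have hO : IsOpen (Ω ×ˢ (Set.univ : Set ℝ)) := hΩ.prod isOpen_univ
  have hcf : ContinuousOn (fderiv ℝ (fun z : E × ℝ => h z.1 z.2)) (Ω ×ˢ Set.univ) :=
    hh.continuousOn_fderiv_of_isOpen hO le_rfl
  have hdiff : ∀ q ∈ Ω, ∀ x : ℝ, DifferentiableAt ℝ (fun z : E × ℝ => h z.1 z.2) (q, x) :=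
    fun q hq x => (hh.contDiffAt (hO.mem_nhds ⟨hq, trivial⟩)).differentiableAt one_ne_zero
  have hcx : ∀ q ∈ Ω, Continuous (h q) := fun q hq => by
    refine hh.continuousOn.comp_continuous (f := fun x : ℝ => (q, x)) (by fun_prop) fun x => ?_
    exact ⟨hq, trivial⟩
  have hcd : Continuous fun x => fderiv ℝ (fun z : E × ℝ => h z.1 z.2) (p, x) := by
    refine hcf.comp_continuous (f := fun x : ℝ => (p, x)) (by fun_prop) fun x => ?_
    exact ⟨hp, trivial⟩
  obtain ⟨C, hC⟩ := isCompact_uIcc.exists_bound_of_continuousOn (s := Set.uIcc a b)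
    hcd.continuousOn
  -- the bound extends from `{p} × [a, b]` to a neighbourhood by compactness
  have hbound : ∀ᶠ q in 𝓝 p, ∀ x ∈ Set.uIcc a b,
      ‖fderiv ℝ (fun z : E × ℝ => h z.1 z.2) (q, x)‖ ≤ C + 1 := by
    refine isCompact_uIcc.eventually_forall_of_forall_eventually fun x hx => ?_
    have hca := (hcf.continuousAt (hO.mem_nhds (⟨hp, trivial⟩ : (p, x) ∈ Ω ×ˢ Set.univ))).norm
    have : ∀ᶠ z in 𝓝 (p, x), ‖fderiv ℝ (fun z : E × ℝ => h z.1 z.2) z‖ < C + 1 :=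
      hca.eventually_lt continuousAt_const (by linarith [hC x hx])
    exact this.mono fun z hz => hz.le
  have hs : {q | q ∈ Ω ∧ ∀ x ∈ Set.uIcc a b,
      ‖fderiv ℝ (fun z : E × ℝ => h z.1 z.2) (q, x)‖ ≤ C + 1} ∈ 𝓝 p :=
    (hΩ.eventually_mem hp).and hbound
  refine intervalIntegral.hasFDerivAt_integral_of_dominated_of_fderiv_le
    (F' := fun q x => (fderiv ℝ (fun z : E × ℝ => h z.1 z.2) (q, x)).comp
        (ContinuousLinearMap.inl ℝ E ℝ)) (bound := fun _ => C + 1) hs ?_ ?_ ?_ ?_ ?_ ?_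
  · exact (hΩ.eventually_mem hp).mono fun q hq => (hcx q hq).aestronglyMeasurable
  · exact (hcx p hp).intervalIntegrable _ _
  · exact (hcd.clm_comp continuous_const).aestronglyMeasurable
  · refine Eventually.of_forall fun x hx q hq => ?_
    refine (ContinuousLinearMap.opNorm_comp_le _ _).trans ?_
    have h1 := hq.2 x (Set.uIoc_subset_uIcc hx)
    have h2 := ContinuousLinearMap.norm_inl_le_one ℝ E ℝ
    nlinarith [norm_nonneg (fderiv ℝ (fun z : E × ℝ => h z.1 z.2) (q, x))]
  · exact intervalIntegrable_const
  · refine Eventually.of_forall fun x _ q hq => ?_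
    exact hasFDerivAt_section_left (hdiff q hq.1 x)

/-- The Leibniz rule for a variable upper endpoint, in the form of directional derivatives. -/
theorem differentiableAt_integral_variable_endpoint {E : Type*} [NormedAddCommGroup E]
    [NormedSpace ℝ E] {Ω : Set E} (hΩ : IsOpen Ω) {h : E → ℝ → ℝ}
    (hh : ContDiffOn ℝ 1 (fun z : E × ℝ => h z.1 z.2) (Ω ×ˢ Set.univ)) {p : E} (hp : p ∈ Ω)
    (a : ℝ) {τ : E → ℝ} (hτ : DifferentiableAt ℝ τ p) :
    DifferentiableAt ℝ (fun q => ∫ x in a..τ q, h q x) p ∧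
      ∀ v, lineDeriv ℝ (fun q => ∫ x in a..τ q, h q x) p v =
        (∫ x in a..τ p, lineDeriv ℝ (fun q => h q x) p v) +
          lineDeriv ℝ τ p v * h p (τ p) := by
  have hO : IsOpen (Ω ×ˢ (Set.univ : Set ℝ)) := hΩ.prod isOpen_univ
  have hcf : ContinuousOn (fderiv ℝ (fun z : E × ℝ => h z.1 z.2)) (Ω ×ˢ Set.univ) :=
    hh.continuousOn_fderiv_of_isOpen hO le_rfl
  have hcd : Continuous fun x => fderiv ℝ (fun z : E × ℝ => h z.1 z.2) (p, x) := by
    refine hcf.comp_continuous (f := fun x : ℝ => (p, x)) (by fun_prop) fun x => ?_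
    exact ⟨hp, trivial⟩
  have hcx : ∀ q ∈ Ω, Continuous (h q) := fun q hq => by
    refine hh.continuousOn.comp_continuous (f := fun x : ℝ => (q, x)) (by fun_prop) fun x => ?_
    exact ⟨hq, trivial⟩
  have hsecond : HasFDerivAt (fun q => ∫ x in τ p..τ q, h q x)
      (h p (τ p) • fderiv ℝ τ p) p := by
    have hO1 : (fun q => (∫ x in τ p..τ q, h q x) - (τ q - τ p) * h p (τ p)) =o[𝓝 p]
        fun q => τ q - τ p := by
      rw [Asymptotics.isLittleO_iff]
      intro ε hε
      have hca : ContinuousAt (fun z : E × ℝ => h z.1 z.2) (p, τ p) :=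
        hh.continuousOn.continuousAt (hO.mem_nhds ⟨hp, trivial⟩)
      obtain ⟨δ, hδ, hδ'⟩ := Metric.continuousAt_iff.1 hca ε hε
      filter_upwards [hΩ.eventually_mem hp, Metric.ball_mem_nhds p hδ,
        hτ.continuousAt (Metric.ball_mem_nhds (τ p) hδ)] with q hq hqδ hτδ
      have e : (∫ x in τ p..τ q, h q x) - (τ q - τ p) * h p (τ p) =
          ∫ x in τ p..τ q, (h q x - h p (τ p)) := by
        rw [intervalIntegral.integral_sub ((hcx q hq).intervalIntegrable _ _)
          intervalIntegrable_const, intervalIntegral.integral_const, smul_eq_mul]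
      rw [e, Real.norm_eq_abs (τ q - τ p)]
      refine intervalIntegral.norm_integral_le_of_norm_le_const fun x hx => ?_
      have hx' : dist x (τ p) < δ := by
        rw [Real.dist_eq]
        refine lt_of_le_of_lt ?_ hτδ
        rw [Real.dist_eq, abs_sub_comm (τ q)]
        exact (Set.abs_sub_left_of_mem_uIcc (Set.uIoc_subset_uIcc hx)).trans
          (by rw [abs_sub_comm])
      have := hδ' (x := (q, x)) (by rw [Prod.dist_eq]; exact max_lt hqδ hx')
      rw [Real.dist_eq] at this
      exact this.le
    have hO2 := hO1.trans_isBigO hτ.hasFDerivAt.isBigO_sub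
    have hO3 := (hτ.hasFDerivAt.isLittleO).const_mul_left (h p (τ p))
    refine HasFDerivAt.of_isLittleO ((hO2.add hO3).congr_left fun q => ?_)
    simp [smul_eq_mul]
    ring
  have hfirst := hasFDerivAt_integral_of_contDiffOn hΩ hh hp a (τ p)
  have hsum : HasFDerivAt (fun q => ∫ x in a..τ q, h q x)
      ((∫ x in a..τ p, (fderiv ℝ (fun z : E × ℝ => h z.1 z.2) (p, x)).comp
        (ContinuousLinearMap.inl ℝ E ℝ)) + h p (τ p) • fderiv ℝ τ p) p := by
    refine (hfirst.add hsecond).congr_of_eventuallyEq ?_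
    filter_upwards [hΩ.eventually_mem hp] with q hq
    exact (intervalIntegral.integral_add_adjacent_intervals
      ((hcx q hq).intervalIntegrable _ _) ((hcx q hq).intervalIntegrable _ _)).symm
  refine ⟨hsum.differentiableAt, fun v => ?_⟩
  rw [hsum.differentiableAt.lineDeriv_eq_fderiv, hsum.fderiv, hτ.lineDeriv_eq_fderiv]
  have hint : IntervalIntegrable (fun x => (fderiv ℝ (fun z : E × ℝ => h z.1 z.2) (p, x)).comp
        (ContinuousLinearMap.inl ℝ E ℝ)) volume a (τ p) :=
    (hcd.clm_comp continuous_const).intervalIntegrable _ _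
  rw [add_apply, ContinuousLinearMap.intervalIntegral_apply hint]
  simp only [ContinuousLinearMap.comp_apply, ContinuousLinearMap.inl_apply, smul_eq_mul,
    smul_apply, mul_comm (h p (τ p))]
  congr 1
  refine intervalIntegral.integral_congr fun x _ => ?_
  have hd := hasFDerivAt_section_left (p := p) (x := x)
    ((hh.contDiffAt (hO.mem_nhds (⟨hp, trivial⟩ : (p, x) ∈ Ω ×ˢ Set.univ))).differentiableAt
      one_ne_zero)
  simp only [hd.differentiableAt.lineDeriv_eq_fderiv, hd.fderiv]
  rfl

/-! ### Smooth dependence of the profile on the parameters -/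

namespace IsPeriodicWaveFamily

variable {f F : ℝ → ℝ} {Ω : Set Param} {u : Param → ℝ → ℝ}

theorem contDiffAt (hu : IsPeriodicWaveFamily f F Ω u) {p : Param} (hp : p ∈ Ω) (x : ℝ) :
    ContDiffAt ℝ 1 (fun z : Param × ℝ => u z.1 z.2) (p, x) :=
  hu.contDiffOn.contDiffAt ((hu.isOpen.prod isOpen_univ).mem_nhds ⟨hp, trivial⟩)

theorem differentiableAt_uncurry (hu : IsPeriodicWaveFamily f F Ω u) {p : Param} (hp : p ∈ Ω)
    (x : ℝ) : DifferentiableAt ℝ (fun z : Param × ℝ => u z.1 z.2) (p, x) :=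
  (hu.contDiffAt hp x).differentiableAt one_ne_zero

theorem differentiableAt_param (hu : IsPeriodicWaveFamily f F Ω u) {p : Param} (hp : p ∈ Ω)
    (x : ℝ) : DifferentiableAt ℝ (fun q => u q x) p :=
  (hasFDerivAt_section_left (hu.differentiableAt_uncurry hp x)).differentiableAt

theorem hasLineDerivAt (hu : IsPeriodicWaveFamily f F Ω u) {p : Param} (hp : p ∈ Ω)
    (x : ℝ) (v : Param) : HasLineDerivAt ℝ (fun q => u q x) (uParam u v p x) p v :=
  (hu.differentiableAt_param hp x).lineDifferentiableAt.hasLineDerivAt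

theorem uParam_eq_fderiv (hu : IsPeriodicWaveFamily f F Ω u) {p : Param} (hp : p ∈ Ω)
    (x : ℝ) (v : Param) :
    uParam u v p x = fderiv ℝ (fun z : Param × ℝ => u z.1 z.2) (p, x) (v, 0) := by
  have h := hasFDerivAt_section_left (hu.differentiableAt_uncurry hp x)
  rw [uParam, h.differentiableAt.lineDeriv_eq_fderiv, h.fderiv]
  rfl

theorem continuousOn_fderiv (hu : IsPeriodicWaveFamily f F Ω u) :
    ContinuousOn (fderiv ℝ (fun z : Param × ℝ => u z.1 z.2)) (Ω ×ˢ Set.univ) :=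
  hu.contDiffOn.continuousOn_fderiv_of_isOpen (hu.isOpen.prod isOpen_univ) le_rfl

theorem continuous_uParam (hu : IsPeriodicWaveFamily f F Ω u) {p : Param} (hp : p ∈ Ω)
    (v : Param) : Continuous (uParam u v p) := by
  have hcd : Continuous fun x => fderiv ℝ (fun z : Param × ℝ => u z.1 z.2) (p, x) := by
    refine hu.continuousOn_fderiv.comp_continuous (f := fun x : ℝ => (p, x)) (by fun_prop)
      fun x => ?_
    exact ⟨hp, trivial⟩
  rw [funext fun x => hu.uParam_eq_fderiv hp x v]
  exact hcd.clm_apply continuous_const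

theorem continuous (hu : IsPeriodicWaveFamily f F Ω u) {p : Param} (hp : p ∈ Ω) :
    Continuous (u p) := (hu.contDiff p hp).continuous

theorem hasDerivAt (hu : IsPeriodicWaveFamily f F Ω u) {p : Param} (hp : p ∈ Ω) (x : ℝ) :
    HasDerivAt (u p) (deriv (u p) x) x :=
  ((hu.contDiff p hp).differentiable two_ne_zero x).hasDerivAt

theorem hasDerivAt_deriv (hu : IsPeriodicWaveFamily f F Ω u) {p : Param} (hp : p ∈ Ω) (x : ℝ) :
    HasDerivAt (deriv (u p)) (p.1 + p.2.2 * u p x - f (u p x)) x := by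
  rw [← hu.profile p hp x]
  have h : ContDiff ℝ 1 (deriv (u p)) := (contDiff_succ_iff_deriv.1 (hu.contDiff p hp)).2.2
  exact (h.differentiable one_ne_zero x).hasDerivAt

theorem continuous_deriv (hu : IsPeriodicWaveFamily f F Ω u) {p : Param} (hp : p ∈ Ω) :
    Continuous (deriv (u p)) :=
  continuous_iff_continuousAt.2 fun x => (hu.hasDerivAt_deriv hp x).continuousAt

theorem hasDerivAt_deriv_deriv (hu : IsPeriodicWaveFamily f F Ω u) (hf : ContDiff ℝ 2 f)
    {p : Param} (hp : p ∈ Ω) (x : ℝ) :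
    HasDerivAt (deriv (deriv (u p))) ((p.2.2 - deriv f (u p x)) * deriv (u p) x) x := by
  rw [funext (hu.profile p hp)]
  have hfd : HasDerivAt f (deriv f (u p x)) (u p x) :=
    (hf.differentiable two_ne_zero _).hasDerivAt
  have hux := hu.hasDerivAt hp x
  refine (((hux.const_mul p.2.2).const_add p.1).sub (hfd.comp x hux)).congr_deriv ?_
  ring

theorem deriv_eq_fderiv (hu : IsPeriodicWaveFamily f F Ω u) {p : Param} (hp : p ∈ Ω) (x : ℝ) :
    deriv (u p) x = fderiv ℝ (fun z : Param × ℝ => u z.1 z.2) (p, x) (0, 1) := by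
  have h := HasFDerivAt.comp_hasDerivAt (f := fun x : ℝ => (p, x)) x
    (hu.differentiableAt_uncurry hp x).hasFDerivAt ((hasDerivAt_const x p).prodMk (hasDerivAt_id x))
  exact h.deriv

theorem continuousAt_deriv (hu : IsPeriodicWaveFamily f F Ω u) {p : Param} (hp : p ∈ Ω) (x : ℝ) :
    ContinuousAt (fun z : Param × ℝ => deriv (u z.1) z.2) (p, x) := by
  have hO := (hu.isOpen.prod isOpen_univ).mem_nhds (⟨hp, trivial⟩ : (p, x) ∈ Ω ×ˢ Set.univ)
  refine ((hu.continuousOn_fderiv.continuousAt hO).clm_apply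
    (continuousAt_const (y := ((0, 1) : Param × ℝ)))).congr ?_
  filter_upwards [hO] with z hz
  exact (hu.deriv_eq_fderiv hz.1 z.2).symm

theorem contDiffOn_force (hu : IsPeriodicWaveFamily f F Ω u) (hf : ContDiff ℝ 2 f) :
    ContDiffOn ℝ 1 (fun z : Param × ℝ => z.1.1 + z.1.2.2 * u z.1 z.2 - f (u z.1 z.2))
      (Ω ×ˢ Set.univ) := by
  have h := hu.contDiffOn
  have hf1 : ContDiff ℝ 1 f := hf.of_le one_le_two
  refine (ContDiffOn.add ?_ (ContDiffOn.mul ?_ h)).sub (hf1.comp_contDiffOn h)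
  · exact (by fun_prop : ContDiff ℝ 1 fun z : Param × ℝ => z.1.1).contDiffOn
  · exact (by fun_prop : ContDiff ℝ 1 fun z : Param × ℝ => z.1.2.2).contDiffOn

theorem hasLineDerivAt_force (hu : IsPeriodicWaveFamily f F Ω u) (hf : ContDiff ℝ 2 f)
    {p : Param} (hp : p ∈ Ω) (x : ℝ) (v : Param) :
    HasLineDerivAt ℝ (fun q : Param => q.1 + q.2.2 * u q x - f (u q x))
      ((p.2.2 - deriv f (u p x)) * uParam u v p x + (v.1 + v.2.2 * u p x)) p v := by
  have hux : HasDerivAt (fun t : ℝ => u (p + t • v) x) (uParam u v p x) 0 :=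
    hu.hasLineDerivAt hp x v
  have h1 : HasDerivAt (fun t : ℝ => (p + t • v).1) v.1 0 := by
    simpa using ((hasDerivAt_id (0 : ℝ)).mul_const v.1).const_add p.1
  have h2 : HasDerivAt (fun t : ℝ => (p + t • v).2.2) v.2.2 0 := by
    simpa using ((hasDerivAt_id (0 : ℝ)).mul_const v.2.2).const_add p.2.2
  have hfd : HasDerivAt f (deriv f (u p x)) (u (p + (0 : ℝ) • v) x) := by
    simpa using (hf.differentiable two_ne_zero (u p x)).hasDerivAt
  refine ((h1.add (h2.mul hux)).sub (hfd.comp (0 : ℝ) hux)).congr_deriv ?_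
  simp only [zero_smul, add_zero]
  ring

/-- `u_x` is differentiable in the parameters: it can be recovered, through Taylor's formula, from
`u` and `u_xx = a + c u - f(u)`, which are jointly `C¹`. The parameter derivatives of `u` satisfy
the differentiated formula. -/
theorem taylor_uParam (hu : IsPeriodicWaveFamily f F Ω u) (hf : ContDiff ℝ 2 f)
    {p : Param} (hp : p ∈ Ω) (x₀ : ℝ) :
    DifferentiableAt ℝ (fun q => deriv (u q) x₀) p ∧ ∀ v x,
      uParam u v p x = uParam u v p x₀ + (x - x₀) * lineDeriv ℝ (fun q => deriv (u q) x₀) p v +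
        ∫ s in x₀..x, (x - s) *
          ((p.2.2 - deriv f (u p s)) * uParam u v p s + (v.1 + v.2.2 * u p s)) := by
  have hint : ∀ x, DifferentiableAt ℝ (fun q : Param => ∫ s in x₀..x,
        (x - s) * (q.1 + q.2.2 * u q s - f (u q s))) p ∧
      ∀ v, lineDeriv ℝ (fun q : Param => ∫ s in x₀..x,
        (x - s) * (q.1 + q.2.2 * u q s - f (u q s))) p v =
        ∫ s in x₀..x, (x - s) *
          ((p.2.2 - deriv f (u p s)) * uParam u v p s + (v.1 + v.2.2 * u p s)) := by
    intro x
    have hc : ContDiffOn ℝ 1 (fun z : Param × ℝ =>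
        (x - z.2) * (z.1.1 + z.1.2.2 * u z.1 z.2 - f (u z.1 z.2))) (Ω ×ˢ Set.univ) :=
      (by fun_prop : ContDiff ℝ 1 fun z : Param × ℝ => x - z.2).contDiffOn.mul
        (hu.contDiffOn_force hf)
    have h := differentiableAt_integral_variable_endpoint hu.isOpen
      (h := fun (q : Param) s => (x - s) * (q.1 + q.2.2 * u q s - f (u q s))) hc hp x₀
      (differentiableAt_const x)
    refine ⟨h.1, fun v => ?_⟩
    rw [h.2 v, (differentiableAt_const x).lineDeriv_eq_fderiv]
    simp only [fderiv_fun_const, Pi.zero_apply, zero_apply, zero_mul, add_zero]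
    refine intervalIntegral.integral_congr fun s _ => ?_
    exact HasLineDerivAt.lineDeriv
      (HasDerivAt.const_mul (x - s) (hu.hasLineDerivAt_force hf hp s v))
  have htaylor : ∀ q ∈ Ω, ∀ x, u q x = u q x₀ + (x - x₀) * deriv (u q) x₀ +
      ∫ s in x₀..x, (x - s) * (q.1 + q.2.2 * u q s - f (u q s)) := fun q hq x =>
    taylor_integral (by have := hu.continuous hq; have := hf.continuous; fun_prop)
      (hu.hasDerivAt hq) (hu.hasDerivAt_deriv hq) x₀ x
  have hd : DifferentiableAt ℝ (fun q => deriv (u q) x₀) p := by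
    refine (((hu.differentiableAt_param hp (x₀ + 1)).sub
      (hu.differentiableAt_param hp x₀)).sub (hint (x₀ + 1)).1).congr_of_eventuallyEq ?_
    filter_upwards [hu.isOpen.eventually_mem hp] with q hq
    have := htaylor q hq (x₀ + 1)
    simp only [Pi.sub_apply]
    linarith
  refine ⟨hd, fun v x => ?_⟩
  rw [← (hint x).2 v]
  have h3 : HasDerivAt (fun t : ℝ => u (p + t • v) x) _ 0 :=
    ((hu.hasLineDerivAt hp x₀ v).add (HasDerivAt.const_mul (x - x₀)
      (hd.lineDifferentiableAt (v := v)).hasLineDerivAt)).add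
      ((hint x).1.lineDifferentiableAt (v := v)).hasLineDerivAt |>.congr_of_eventuallyEq (by
        have hcont : ContinuousAt (fun t : ℝ => p + t • v) 0 := by fun_prop
        have : ∀ᶠ t in 𝓝 (0 : ℝ), p + t • v ∈ Ω :=
          hcont.eventually (hu.isOpen.eventually_mem (by simpa using hp))
        filter_upwards [this] with t ht
        exact htaylor _ ht x)
  exact h3.deriv

theorem continuous_source (hu : IsPeriodicWaveFamily f F Ω u) (hf : ContDiff ℝ 2 f)
    {p : Param} (hp : p ∈ Ω) (v : Param) : Continuous fun s =>
      (p.2.2 - deriv f (u p s)) * uParam u v p s + (v.1 + v.2.2 * u p s) := by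
  have h1 := hu.continuous hp
  have h2 := hu.continuous_uParam hp v
  have h3 : Continuous (deriv f) := hf.continuous_deriv one_le_two
  fun_prop

/-- `∂ₓ` and the parameter derivatives commute. -/
theorem hasDerivAt_uParam (hu : IsPeriodicWaveFamily f F Ω u) (hf : ContDiff ℝ 2 f)
    {p : Param} (hp : p ∈ Ω) (v : Param) (x : ℝ) :
    HasDerivAt (uParam u v p) (lineDeriv ℝ (fun q => deriv (u q) x) p v) x := by
  have h := hasDerivAt_taylor_integral (hu.continuous_source hf hp v) (uParam u v p x)
    (lineDeriv ℝ (fun q => deriv (u q) x) p v) x x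
  rw [← funext fun y => (hu.taylor_uParam hf hp x).2 v y] at h
  simpa using h

/-- The equation of variations: `-u_v'' - f'(u) u_v + c u_v = -(v_a + v_c u)`. -/
theorem hasDerivAt_deriv_uParam (hu : IsPeriodicWaveFamily f F Ω u) (hf : ContDiff ℝ 2 f)
    {p : Param} (hp : p ∈ Ω) (v : Param) (x : ℝ) :
    HasDerivAt (deriv (uParam u v p))
      ((p.2.2 - deriv f (u p x)) * uParam u v p x + (v.1 + v.2.2 * u p x)) x := by
  have h : ∀ y, HasDerivAt (uParam u v p) _ y := fun y => by
    have h := hasDerivAt_taylor_integral (hu.continuous_source hf hp v) (uParam u v p 0)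
      (lineDeriv ℝ (fun q => deriv (u q) 0) p v) 0 y
    rwa [← funext fun y => (hu.taylor_uParam hf hp 0).2 v y] at h
  rw [funext fun y => (h y).deriv]
  exact ((hu.continuous_source hf hp v).integral_hasStrictDerivAt 0 x).hasDerivAt.const_add _

/-- The Wronskian of `u_x` and `u_v`, found by differentiating the energy identity. -/
theorem wronskian_uParam (hu : IsPeriodicWaveFamily f F Ω u) (hf : ContDiff ℝ 2 f)
    (hF : ∀ y, HasDerivAt F (f y) y) {p : Param} (hp : p ∈ Ω) (v : Param) (x : ℝ) :
    deriv (u p) x * deriv (uParam u v p) x - deriv (deriv (u p)) x * uParam u v p x =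
      v.2.1 + v.1 * u p x + v.2.2 * (u p x ^ 2 / 2) := by
  have hux : HasDerivAt (fun t : ℝ => u (p + t • v) x) (uParam u v p x) 0 :=
    hu.hasLineDerivAt hp x v
  have hd : HasDerivAt (fun t : ℝ => deriv (u (p + t • v)) x) (deriv (uParam u v p) x) 0 := by
    rw [(hu.hasDerivAt_uParam hf hp v x).deriv]
    exact (hu.taylor_uParam hf hp x).1.lineDifferentiableAt.hasLineDerivAt
  have h1 : HasDerivAt (fun t : ℝ => (p + t • v).1) v.1 0 := by
    simpa using ((hasDerivAt_id (0 : ℝ)).mul_const v.1).const_add p.1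
  have h2 : HasDerivAt (fun t : ℝ => (p + t • v).2.2) v.2.2 0 := by
    simpa using ((hasDerivAt_id (0 : ℝ)).mul_const v.2.2).const_add p.2.2
  have h3 : HasDerivAt (fun t : ℝ => (p + t • v).2.1) v.2.1 0 := by
    simpa using ((hasDerivAt_id (0 : ℝ)).mul_const v.2.1).const_add p.2.1
  have hFd : HasDerivAt F (f (u p x)) (u (p + (0 : ℝ) • v) x) := by simpa using hF (u p x)
  have hl := (hd.pow 2).div_const 2
  have hr := ((h3.add (h1.mul hux)).add ((h2.mul (hux.pow 2)).div_const 2)).sub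
    (hFd.comp (0 : ℝ) hux)
  have heq := hl.unique (hr.congr_of_eventuallyEq (by
    have hcont : ContinuousAt (fun t : ℝ => p + t • v) 0 := by fun_prop
    have : ∀ᶠ t in 𝓝 (0 : ℝ), p + t • v ∈ Ω :=
      hcont.eventually (hu.isOpen.eventually_mem (by simpa using hp))
    filter_upwards [this] with t ht
    simpa using hu.energy _ ht x))
  rw [hu.profile p hp x]
  simp at heq
  linarith

end IsPeriodicWaveFamily

/-! ### The fundamental period -/

namespace IsPeriodicWaveFamily

variable {f F : ℝ → ℝ} {Ω : Set Param} {u : Param → ℝ → ℝ}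

theorem isLeast_period (hu : IsPeriodicWaveFamily f F Ω u) {p : Param} (hp : p ∈ Ω) :
    IsLeast {t | 0 < t ∧ Function.Periodic (u p) t} (period u p) := by
  obtain ⟨T, hT, -⟩ :=
    exists_isLeast_period (hu.continuous hp) (hu.periodic p hp) (hu.nonconstant p hp)
  rw [period, hT.csInf_eq]
  exact hT

theorem period_pos (hu : IsPeriodicWaveFamily f F Ω u) {p : Param} (hp : p ∈ Ω) :
    0 < period u p := (hu.isLeast_period hp).1.1

theorem periodic_period (hu : IsPeriodicWaveFamily f F Ω u) {p : Param} (hp : p ∈ Ω) :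
    Function.Periodic (u p) (period u p) := (hu.isLeast_period hp).1.2

theorem deriv_add_period (hu : IsPeriodicWaveFamily f F Ω u) {p : Param} (hp : p ∈ Ω) :
    Function.Periodic (deriv (u p)) (period u p) := by
  intro x
  have h := (hu.hasDerivAt hp (x + period u p)).comp_add_const x (period u p)
  rw [funext (hu.periodic_period hp)] at h
  exact h.deriv.symm

theorem exists_eq_nat_mul_period (hu : IsPeriodicWaveFamily f F Ω u) {p : Param} (hp : p ∈ Ω)
    {t : ℝ} (ht : 0 < t) (hper : Function.Periodic (u p) t) :
    ∃ n : ℕ, 1 ≤ n ∧ t = n * period u p := by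
  obtain ⟨T, hT, h⟩ :=
    exists_isLeast_period (hu.continuous hp) (hu.periodic p hp) (hu.nonconstant p hp)
  rw [(hu.isLeast_period hp).unique hT]
  exact h t ht hper

theorem exists_deriv_ne_zero (hu : IsPeriodicWaveFamily f F Ω u) {p : Param} (hp : p ∈ Ω) :
    ∃ x, deriv (u p) x ≠ 0 := by
  by_contra! h
  obtain ⟨x, y, hxy⟩ := hu.nonconstant p hp
  exact hxy (is_const_of_deriv_eq_zero (fun z => (hu.hasDerivAt hp z).differentiableAt) h x y)

/-- A return of `(u, u_x)` to an earlier value is a period, by uniqueness for the profile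
equation. -/
theorem periodic_of_return (hu : IsPeriodicWaveFamily f F Ω u) (hf : ContDiff ℝ 2 f)
    {p : Param} (hp : p ∈ Ω) {x₁ τ : ℝ} (h₀ : u p (x₁ + τ) = u p x₁)
    (h₁ : deriv (u p) (x₁ + τ) = deriv (u p) x₁) : Function.Periodic (u p) τ := by
  intro x
  have hc := hu.continuous hp
  have hc' := hu.continuous_deriv hp
  let X : ℝ → ℝ × ℝ := fun s => (u p s, deriv (u p) s)
  let field : ℝ × ℝ → ℝ × ℝ := fun y => (y.2, p.1 + p.2.2 * y.1 - f y.1)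
  have hX : ∀ s, HasDerivAt X (field (X s)) s := fun s =>
    (hu.hasDerivAt hp s).prodMk (hu.hasDerivAt_deriv hp s)
  have hX' : ∀ s, HasDerivAt (fun s => X (s + τ)) (field (X (s + τ))) s := fun s =>
    (hX (s + τ)).comp_add_const s τ
  have hXc : Continuous X := hc.prodMk hc'
  set a := min x x₁ - 1
  set b := max x x₁ + 1
  obtain ⟨R₁, hR₁⟩ := isCompact_Icc.exists_bound_of_continuousOn (s := Set.Icc a b)
    hXc.continuousOn
  obtain ⟨R₂, hR₂⟩ := isCompact_Icc.exists_bound_of_continuousOn (s := Set.Icc a b)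
    (hXc.comp (continuous_add_const τ)).continuousOn
  have hfield : ContDiff ℝ 1 field := by
    have : ContDiff ℝ 1 f := hf.of_le one_le_two
    fun_prop
  obtain ⟨K, hK⟩ := hfield.contDiffOn.exists_lipschitzOnWith one_ne_zero
    (convex_closedBall (0 : ℝ × ℝ) (max R₁ R₂)) (isCompact_closedBall _ _)
  have hmem : x₁ ∈ Set.Ioo a b :=
    ⟨by have := min_le_right x x₁; simp only [a]; linarith,
      by have := le_max_right x x₁; simp only [b]; linarith⟩
  have heq := ODE_solution_unique_of_mem_Icc (v := fun _ => field)
    (s := fun _ => Metric.closedBall 0 (max R₁ R₂)) (f := fun s => X (s + τ)) (g := X)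
    (fun _ _ => hK) hmem (hXc.comp (continuous_add_const τ)).continuousOn (fun s _ => hX' s)
    (fun s hs => mem_closedBall_zero_iff.2
      ((hR₂ s (Set.Ioo_subset_Icc_self hs)).trans (le_max_right _ _)))
    hXc.continuousOn (fun s _ => hX s)
    (fun s hs => mem_closedBall_zero_iff.2
      ((hR₁ s (Set.Ioo_subset_Icc_self hs)).trans (le_max_left _ _)))
    (Prod.ext h₀ h₁)
  have hx : x ∈ Set.Icc a b :=
    ⟨by have := min_le_left x x₁; simp only [a]; linarith,
      by have := le_max_left x x₁; simp only [b]; linarith⟩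
  exact congrArg Prod.fst (heq hx)

/-- The implicit function theorem continues the period `T(p)` to a differentiable family of return
times, which are periods because the energy identity makes `u_x` return together with `u`. -/
theorem exists_differentiable_period (hu : IsPeriodicWaveFamily f F Ω u) (hf : ContDiff ℝ 2 f)
    {p : Param} (hp : p ∈ Ω) :
    ∃ ψ : Param → ℝ, DifferentiableAt ℝ ψ p ∧ ψ p = period u p ∧
      ∀ᶠ q in 𝓝 p, Function.Periodic (u q) (ψ q) := by
  obtain ⟨x₁, hx₁⟩ := hu.exists_deriv_ne_zero hp
  set T := period u p
  have hdT : deriv (u p) (x₁ + T) = deriv (u p) x₁ := hu.deriv_add_period hp x₁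
  let Φ : Param × ℝ → ℝ := fun z => u z.1 (x₁ + z.2) - u z.1 x₁
  have hΦ : ContDiffAt ℝ 1 Φ (p, T) := by
    refine ContDiffAt.sub ?_ ?_
    · exact ContDiffAt.comp (g := fun z : Param × ℝ => u z.1 z.2)
        (f := fun z : Param × ℝ => (z.1, x₁ + z.2)) (p, T) (hu.contDiffAt hp (x₁ + T))
        (by fun_prop)
    · exact ContDiffAt.comp (g := fun z : Param × ℝ => u z.1 z.2)
        (f := fun z : Param × ℝ => (z.1, x₁)) (p, T) (hu.contDiffAt hp x₁) (by fun_prop)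
  have hst : HasStrictFDerivAt Φ (fderiv ℝ Φ (p, T)) (p, T) :=
    hΦ.hasStrictFDerivAt one_ne_zero
  have hpart : fderiv ℝ Φ (p, T) (0, 1) = deriv (u p) x₁ := by
    have h1 := HasFDerivAt.comp_hasDerivAt (f := fun t : ℝ => (p, t)) T
      hst.hasFDerivAt ((hasDerivAt_const T p).prodMk (hasDerivAt_id T))
    have h2 : HasDerivAt (fun t => u p (x₁ + t) - u p x₁) (deriv (u p) (x₁ + T)) T :=
      ((hu.hasDerivAt hp (x₁ + T)).comp_const_add x₁ T).sub_const _
    rw [← hdT]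
    exact h1.unique h2
  have hinv : (fderiv ℝ Φ (p, T) ∘L ContinuousLinearMap.inr ℝ Param ℝ).IsInvertible := by
    refine ⟨ContinuousLinearEquiv.unitsEquivAut ℝ (Units.mk0 _ hx₁), ?_⟩
    ext
    simp [hpart]
  set ψ := hst.implicitFunctionOfProdDomain hinv
  have hψd : DifferentiableAt ℝ ψ p :=
    (hst.hasStrictFDerivAt_implicitFunctionOfProdDomain hinv).hasFDerivAt.differentiableAt
  have hψT : ψ p = T :=
    (hst.eventually_apply_eq_iff_implicitFunctionOfProdDomain hinv).self_of_nhds.1 rfl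
  refine ⟨ψ, hψd, hψT, ?_⟩
  have hret := hst.eventually_apply_implicitFunctionOfProdDomain hinv
  have hΦT : Φ (p, T) = 0 := sub_eq_zero.2 (hu.periodic_period hp x₁)
  have hψc : ContinuousAt (fun q => deriv (u q) (x₁ + ψ q)) p := by
    refine ContinuousAt.comp (g := fun z : Param × ℝ => deriv (u z.1) z.2)
      (f := fun q => (q, x₁ + ψ q)) (hu.continuousAt_deriv hp _) ?_
    exact continuousAt_id.prodMk (continuousAt_const.add hψd.continuousAt)
  have hc₁ : ContinuousAt (fun q => deriv (u q) x₁) p :=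
    ContinuousAt.comp (g := fun z : Param × ℝ => deriv (u z.1) z.2)
      (f := fun q => (q, x₁)) (hu.continuousAt_deriv hp _) (by fun_prop)
  have hsum : ∀ᶠ q in 𝓝 p, deriv (u q) (x₁ + ψ q) + deriv (u q) x₁ ≠ 0 := by
    refine (hψc.add hc₁).eventually_ne ?_
    change deriv (u p) (x₁ + ψ p) + deriv (u p) x₁ ≠ 0
    rw [hψT, hdT]
    intro h
    exact hx₁ (by linarith)
  filter_upwards [hret, hsum, hu.isOpen.eventually_mem hp] with q hq hs hqΩ
  have h₀ : u q (x₁ + ψ q) = u q x₁ := by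
    rw [hΦT] at hq
    exact sub_eq_zero.1 hq
  refine hu.periodic_of_return hf hqΩ h₀ ?_
  have e₁ := hu.energy q hqΩ (x₁ + ψ q)
  have e₂ := hu.energy q hqΩ x₁
  rw [h₀] at e₁
  have : (deriv (u q) (x₁ + ψ q) - deriv (u q) x₁) *
      (deriv (u q) (x₁ + ψ q) + deriv (u q) x₁) = 0 := by linear_combination 2 * e₁ - 2 * e₂
  exact sub_eq_zero.1 ((mul_eq_zero.1 this).resolve_right hs)

/-- The fundamental period is differentiable. Were a profile near `u(·; p)` to have a smaller
period than the one continued from `T(p)`, it would have a period in `[T(p)/4, 3T(p)/4]`, which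
compactness excludes. -/
theorem differentiableAt_period (hu : IsPeriodicWaveFamily f F Ω u) (hf : ContDiff ℝ 2 f)
    {p : Param} (hp : p ∈ Ω) : DifferentiableAt ℝ (period u) p := by
  obtain ⟨ψ, hψd, hψT, hψ⟩ := hu.exists_differentiable_period hf hp
  have hT := hu.period_pos hp
  set T := period u p with hTdef
  refine hψd.congr_of_eventuallyEq ?_
  have hno : ∀ᶠ q in 𝓝 p, ∀ t ∈ Set.Icc (T / 4) (3 * T / 4), ∃ x, u q (x + t) - u q x ≠ 0 := by
    refine isCompact_Icc.eventually_forall_of_forall_eventually fun t ht => ?_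
    have hnp : ¬ Function.Periodic (u p) t := fun h => by
      have := (hu.isLeast_period hp).2 ⟨by linarith [ht.1], h⟩
      linarith [ht.2]
    obtain ⟨x, hx⟩ := not_forall.1 hnp
    have hc : ContinuousAt (fun z : Param × ℝ => u z.1 (x + z.2) - u z.1 x) (p, t) := by
      refine ContinuousAt.sub ?_ ?_
      · exact ContinuousAt.comp (g := fun z : Param × ℝ => u z.1 z.2)
          (f := fun z : Param × ℝ => (z.1, x + z.2)) (hu.contDiffAt hp (x + t)).continuousAt
          (by fun_prop)
      · exact ContinuousAt.comp (g := fun z : Param × ℝ => u z.1 z.2)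
          (f := fun z : Param × ℝ => (z.1, x)) (hu.contDiffAt hp x).continuousAt
          (by fun_prop)
    exact (hc.eventually_ne (sub_ne_zero.2 hx)).mono fun z hz => ⟨x, hz⟩
  have hnear : ∀ᶠ q in 𝓝 p, |ψ q - T| < T / 4 := by
    have : ContinuousAt (fun q => |ψ q - T|) p := (hψd.continuousAt.sub continuousAt_const).abs
    refine this.eventually_lt continuousAt_const ?_
    simp only [hψT, sub_self, abs_zero]
    linarith
  filter_upwards [hψ, hno, hnear, hu.isOpen.eventually_mem hp] with q hper hn hnr hqΩ
  rw [abs_lt] at hnr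
  obtain ⟨n, hn1, hnψ⟩ := hu.exists_eq_nat_mul_period hqΩ (by linarith) hper
  set Tq := period u q
  have hTq : 0 < Tq := hu.period_pos hqΩ
  by_cases h1 : n = 1
  · rw [hnψ, h1]; simp
  exfalso
  -- the multiple `⌊n / 2⌋ Tq` lies between `ψ q / 3` and `ψ q / 2`
  have hm : (n / 2 : ℕ) * 2 ≤ n ∧ n ≤ 3 * (n / 2 : ℕ) := by omega
  have hm1 : ((n / 2 : ℕ) : ℝ) * 2 ≤ n := by exact_mod_cast hm.1
  have hm2 : (n : ℝ) ≤ 3 * ((n / 2 : ℕ) : ℝ) := by exact_mod_cast hm.2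
  obtain ⟨x, hx⟩ := hn ((n / 2 : ℕ) * Tq)
    ⟨by nlinarith, by nlinarith⟩
  exact hx (sub_eq_zero.2 ((hu.periodic_period hqΩ).nat_mul (n / 2) x))

/-! ### Parameter derivatives of the period, the mass and the momentum -/

theorem differentiableAt_mass (hu : IsPeriodicWaveFamily f F Ω u) (hf : ContDiff ℝ 2 f)
    {p : Param} (hp : p ∈ Ω) : DifferentiableAt ℝ (mass u) p :=
  (differentiableAt_integral_variable_endpoint hu.isOpen hu.contDiffOn hp 0
    (hu.differentiableAt_period hf hp)).1

theorem contDiffOn_sq (hu : IsPeriodicWaveFamily f F Ω u) :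
    ContDiffOn ℝ 1 (fun z : Param × ℝ => u z.1 z.2 ^ 2) (Ω ×ˢ Set.univ) := hu.contDiffOn.pow 2

theorem differentiableAt_momentum (hu : IsPeriodicWaveFamily f F Ω u) (hf : ContDiff ℝ 2 f)
    {p : Param} (hp : p ∈ Ω) : DifferentiableAt ℝ (momentum u) p :=
  (differentiableAt_integral_variable_endpoint hu.isOpen (h := fun q x => u q x ^ 2)
    hu.contDiffOn_sq hp 0 (hu.differentiableAt_period hf hp)).1

theorem integral_uParam (hu : IsPeriodicWaveFamily f F Ω u) (hf : ContDiff ℝ 2 f)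
    {p : Param} (hp : p ∈ Ω) (v : Param) :
    ∫ x in (0 : ℝ)..period u p, uParam u v p x =
      lineDeriv ℝ (mass u) p v - lineDeriv ℝ (period u) p v * u p 0 := by
  have h := (differentiableAt_integral_variable_endpoint hu.isOpen hu.contDiffOn hp 0
    (hu.differentiableAt_period hf hp)).2 v
  have h0 := (hu.periodic_period hp) 0
  rw [zero_add] at h0
  rw [h0] at h
  exact eq_sub_of_add_eq h.symm

theorem integral_mul_uParam (hu : IsPeriodicWaveFamily f F Ω u) (hf : ContDiff ℝ 2 f)
    {p : Param} (hp : p ∈ Ω) (v : Param) :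
    ∫ x in (0 : ℝ)..period u p, u p x * uParam u v p x =
      (lineDeriv ℝ (momentum u) p v - lineDeriv ℝ (period u) p v * u p 0 ^ 2) / 2 := by
  have h := (differentiableAt_integral_variable_endpoint hu.isOpen (h := fun q x => u q x ^ 2)
    hu.contDiffOn_sq hp 0 (hu.differentiableAt_period hf hp)).2 v
  have h0 := (hu.periodic_period hp) 0
  rw [zero_add] at h0
  rw [h0] at h
  have hsq : ∀ x, lineDeriv ℝ (fun q => u q x ^ 2) p v = 2 * (u p x * uParam u v p x) := by
    intro x
    have hux : HasDerivAt (fun t : ℝ => u (p + t • v) x) (uParam u v p x) 0 :=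
      hu.hasLineDerivAt hp x v
    refine (hux.pow 2).deriv.trans ?_
    simp
    ring
  simp only [hsq, intervalIntegral.integral_const_mul] at h
  have h' : lineDeriv ℝ (momentum u) p v = _ := h
  linarith

/-- Differentiating `u(x + T) = u(x)` in the parameters. -/
theorem uParam_add_period (hu : IsPeriodicWaveFamily f F Ω u) (hf : ContDiff ℝ 2 f)
    {p : Param} (hp : p ∈ Ω) (v : Param) (x : ℝ) :
    uParam u v p (x + period u p) =
      uParam u v p x - lineDeriv ℝ (period u) p v * deriv (u p) x := by
  have hT := hu.differentiableAt_period hf hp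
  have h1 : HasFDerivAt (fun q => u q (x + period u q)) _ p :=
    HasFDerivAt.comp (f := fun q => (q, x + period u q))
      (g := fun z : Param × ℝ => u z.1 z.2) p
      (hu.differentiableAt_uncurry hp (x + period u p)).hasFDerivAt
      ((hasFDerivAt_id p).prodMk (hT.hasFDerivAt.const_add x))
  have h2 : HasFDerivAt (fun q => u q x) _ p := h1.congr_of_eventuallyEq (by
    filter_upwards [hu.isOpen.eventually_mem hp] with q hq
    exact (hu.periodic_period hq x).symm)
  have h3 : uParam u v p x = _ := (h2.differentiableAt.lineDeriv_eq_fderiv).trans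
    (congrArg (fun L => L v) h2.fderiv)
  rw [h3, hu.uParam_eq_fderiv hp, hT.lineDeriv_eq_fderiv, ← hu.deriv_add_period hp x,
    hu.deriv_eq_fderiv hp]
  simp only [ContinuousLinearMap.comp_apply, ContinuousLinearMap.prod_apply,
    ContinuousLinearMap.id_apply]
  rw [show (v, fderiv ℝ (period u) p v) =
    ((v, 0) : Param × ℝ) + fderiv ℝ (period u) p v • ((0, 1) : Param × ℝ) by simp]
  rw [map_add, map_smul, smul_eq_mul]
  ring

end IsPeriodicWaveFamily

/-! ### Differential operators on continuous representatives -/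

section Representatives

variable {ℓ : ℝ}

theorem memLp_of_continuous (ℓ : ℝ) {g : ℝ → ℝ} (hg : Continuous g) :
    MemLp g 2 (volume.restrict (Set.Ioc 0 ℓ)) := by
  obtain ⟨C, hC⟩ := isCompact_Icc.exists_bound_of_continuousOn (s := Set.Icc 0 ℓ) hg.continuousOn
  refine MemLp.of_bound hg.aestronglyMeasurable C ?_
  filter_upwards [ae_restrict_mem measurableSet_Ioc] with x hx
  exact hC x (Set.Ioc_subset_Icc_self hx)

theorem coeFn_toL2per (ℓ : ℝ) {g : ℝ → ℝ} (hg : Continuous g) :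
    toL2per ℓ g =ᵐ[volume.restrict (Set.Ioc 0 ℓ)] g := by
  rw [toL2per, dif_pos (memLp_of_continuous ℓ hg)]
  exact MemLp.coeFn_toLp _

theorem eq_toL2per {v : L2per ℓ} {g h : ℝ → ℝ} (hg : v =ᵐ[volume.restrict (Set.Ioc 0 ℓ)] g)
    (hh : Continuous h) (hgh : Set.EqOn g h (Set.Ioc 0 ℓ)) : v = toL2per ℓ h := by
  refine Lp.ext (hg.trans (EventuallyEq.trans ?_ (coeFn_toL2per ℓ hh).symm))
  filter_upwards [ae_restrict_mem measurableSet_Ioc] with x hx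
  exact hgh hx

theorem toL2per_combination (ℓ : ℝ) (s t : ℝ) {g h : ℝ → ℝ} (hg : Continuous g)
    (hh : Continuous h) :
    toL2per ℓ (fun x => s * g x + t * h x) = s • toL2per ℓ g + t • toL2per ℓ h := by
  refine (eq_toL2per (v := s • toL2per ℓ g + t • toL2per ℓ h)
    (g := fun x => s * g x + t * h x) ?_ (by fun_prop) (fun _ _ => rfl)).symm
  filter_upwards [coeFn_toL2per ℓ hg, coeFn_toL2per ℓ hh,
    Lp.coeFn_add (s • toL2per ℓ g) (t • toL2per ℓ h), Lp.coeFn_smul s (toL2per ℓ g),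
    Lp.coeFn_smul t (toL2per ℓ h)] with x e₁ e₂ e₃ e₄ e₅
  simp only [e₃, Pi.add_apply, e₄, e₅, Pi.smul_apply, e₁, e₂, smul_eq_mul]

theorem toL2per_zero (ℓ : ℝ) : toL2per ℓ (fun _ => 0) = 0 :=
  (eq_toL2per (Lp.coeFn_zero _ _ _) continuous_const fun _ _ => rfl).symm

theorem eqOn_zero_of_toL2per_eq_zero (hℓ : 0 < ℓ) {g : ℝ → ℝ} (hg : Continuous g)
    (h : toL2per ℓ g = 0) : Set.EqOn g 0 (Set.Icc 0 ℓ) := by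
  have h0 : g =ᵐ[volume.restrict (Set.Ioc 0 ℓ)] (0 : ℝ → ℝ) := by
    refine (coeFn_toL2per ℓ hg).symm.trans ?_
    rw [h]
    exact Lp.coeFn_zero _ _ _
  have h1 : Set.EqOn g 0 (Set.Ioc 0 ℓ) :=
    Measure.eqOn_Ioc_of_ae_eq (μ := volume) h0 hg.continuousOn continuousOn_const
  refine (h1.closure hg continuous_const).mono ?_
  rw [closure_Ioc hℓ.ne]

theorem integral_congr_L2per {v w : ℝ → ℝ} (h : v =ᵐ[volume.restrict (Set.Ioc 0 ℓ)] w) {x : ℝ}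
    (hx : x ∈ Set.Icc 0 ℓ) : ∫ t in (0 : ℝ)..x, v t = ∫ t in (0 : ℝ)..x, w t := by
  rw [intervalIntegral.integral_of_le hx.1, intervalIntegral.integral_of_le hx.1]
  exact integral_congr_ae (ae_restrict_of_ae_restrict_of_subset
    (Set.Ioc_subset_Ioc_right hx.2) h)

/-- A `C¹` function with matching boundary values lies in the domain of `∂ₓ`. -/
theorem mem_derivOp_of_hasDerivAt {g g' : ℝ → ℝ} (hg : ∀ x, HasDerivAt g (g' x) x)
    (hg' : Continuous g') (hper : g ℓ = g 0) : (toL2per ℓ g, toL2per ℓ g') ∈ derivOp ℓ := by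
  have hc : Continuous g := continuous_iff_continuousAt.2 fun x => (hg x).continuousAt
  refine ⟨g, coeFn_toL2per ℓ hc, hper, fun x hx => ?_⟩
  rw [integral_congr_L2per (coeFn_toL2per ℓ hg') hx,
    intervalIntegral.integral_eq_sub_of_hasDerivAt (fun s _ => hg s) (hg'.intervalIntegrable _ _)]
  ring

/-- The elements that `∂ₓ` maps to the class of a continuous function `r` are the classes of the
primitives of `r`, and exist only if `r` has mean zero. -/
theorem mem_derivOp_toL2per_iff (hℓ : 0 < ℓ) {R r : ℝ → ℝ} (hR : ∀ x, HasDerivAt R (r x) x)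
    (hr : Continuous r) {v : L2per ℓ} :
    (v, toL2per ℓ r) ∈ derivOp ℓ ↔ R ℓ = R 0 ∧ ∃ C, v = toL2per ℓ (fun x => C + R x) := by
  have hc : Continuous R := continuous_iff_continuousAt.2 fun x => (hR x).continuousAt
  constructor
  · rintro ⟨g, hg, hper, hi⟩
    have hi' : ∀ x ∈ Set.Icc 0 ℓ, g x = (g 0 - R 0) + R x := by
      intro x hx
      rw [hi x hx, integral_congr_L2per (coeFn_toL2per ℓ hr) hx,
        intervalIntegral.integral_eq_sub_of_hasDerivAt (fun s _ => hR s)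
          (hr.intervalIntegrable _ _)]
      ring
    refine ⟨?_, g 0 - R 0, eq_toL2per hg (by fun_prop)
      fun x hx => hi' x (Set.Ioc_subset_Icc_self hx)⟩
    have := hi' ℓ ⟨hℓ.le, le_rfl⟩
    linarith
  · rintro ⟨hper, C, rfl⟩
    exact mem_derivOp_of_hasDerivAt (fun x => (hR x).const_add C) hr (by rw [hper])

theorem primitive_regularity (hℓ : 0 ≤ ℓ) {g h : ℝ → ℝ} (hh : ContinuousOn h (Set.Icc 0 ℓ))
    (hg : ∀ x ∈ Set.Icc 0 ℓ, g x = g 0 + ∫ t in (0 : ℝ)..x, h t) :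
    ContinuousOn g (Set.Icc 0 ℓ) ∧ ∀ x ∈ Set.Ioo 0 ℓ, HasDerivAt g (h x) x := by
  have hH : Continuous (Set.IccExtend hℓ ((Set.Icc 0 ℓ).domRestrict h)) :=
    (continuousOn_iff_continuous_domRestrict.1 hh).Icc_extend'
  set H := Set.IccExtend hℓ ((Set.Icc 0 ℓ).domRestrict h)
  have hHh : ∀ x ∈ Set.Icc 0 ℓ, H x = h x := fun x hx => Set.IccExtend_of_mem hℓ _ hx
  have hg' : ∀ x ∈ Set.Icc 0 ℓ, g x = g 0 + ∫ t in (0 : ℝ)..x, H t := by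
    intro x hx
    rw [hg x hx]
    congr 1
    refine intervalIntegral.integral_congr fun s hs => (hHh s ?_).symm
    rw [Set.uIcc_of_le hx.1] at hs
    exact ⟨hs.1, hs.2.trans hx.2⟩
  have hd : ∀ x, HasDerivAt (fun x => g 0 + ∫ t in (0 : ℝ)..x, H t) (H x) x := fun x =>
    (hH.integral_hasStrictDerivAt 0 x).hasDerivAt.const_add _
  refine ⟨ContinuousOn.congr (fun x _ => (hd x).continuousAt.continuousWithinAt) hg',
    fun x hx => ?_⟩
  rw [← hHh x (Set.Ioo_subset_Icc_self hx)]
  refine (hd x).congr_of_eventuallyEq ?_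
  filter_upwards [Icc_mem_nhds hx.1 hx.2] with y hy
  exact hg' y hy

theorem mem_schrodingerOp_of_hasDerivAt {W : ℝ → ℝ} (hW : Continuous W) {c : ℝ} {g g₁ r : ℝ → ℝ}
    (hr : Continuous r) (hg : ∀ x, HasDerivAt g (g₁ x) x)
    (hg₁ : ∀ x, HasDerivAt g₁ ((c - W x) * g x - r x) x) (hper : g ℓ = g 0)
    (hper₁ : g₁ ℓ = g₁ 0) : (toL2per ℓ g, toL2per ℓ r) ∈ schrodingerOp ℓ W c := by
  have hc : Continuous g := continuous_iff_continuousAt.2 fun x => (hg x).continuousAt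
  have hc₁ : Continuous g₁ := continuous_iff_continuousAt.2 fun x => (hg₁ x).continuousAt
  have hc₂ : Continuous fun x => (c - W x) * g x - r x := by fun_prop
  refine ⟨toL2per ℓ g₁, toL2per ℓ _, mem_derivOp_of_hasDerivAt hg hc₁ hper,
    mem_derivOp_of_hasDerivAt hg₁ hc₂ hper₁, ?_⟩
  filter_upwards [coeFn_toL2per ℓ hr, coeFn_toL2per ℓ hc, coeFn_toL2per ℓ hc₂] with x e₁ e₂ e₃
  simp only [e₁, e₂, e₃]
  ring

/-- Regularity: if `-v'' - W v + c v` is continuous then `v` is a classical solution with periodic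
boundary values. -/
theorem exists_classical_of_mem_schrodingerOp (hℓ : 0 < ℓ) {W : ℝ → ℝ} (hW : Continuous W) {c : ℝ}
    {r : ℝ → ℝ} (hr : Continuous r) {v : L2per ℓ}
    (h : (v, toL2per ℓ r) ∈ schrodingerOp ℓ W c) :
    ∃ g g₁ : ℝ → ℝ, v =ᵐ[volume.restrict (Set.Ioc 0 ℓ)] g ∧
      ContinuousOn g (Set.Icc 0 ℓ) ∧ ContinuousOn g₁ (Set.Icc 0 ℓ) ∧ g ℓ = g 0 ∧ g₁ ℓ = g₁ 0 ∧
      (∀ x ∈ Set.Ioo 0 ℓ, HasDerivAt g (g₁ x) x) ∧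
      ∀ x ∈ Set.Ioo 0 ℓ, HasDerivAt g₁ ((c - W x) * g x - r x) x := by
  obtain ⟨v₁, v₂, ⟨g, hg, hper, hi⟩, ⟨g₁, hg₁, hper₁, hi₁⟩, he⟩ := h
  have hc₁ : ContinuousOn g₁ (Set.Icc 0 ℓ) := by
    have := intervalIntegral.continuousOn_primitive_interval
      (f := v₂) (μ := volume) (a := 0) (b := ℓ) (by
        rw [Set.uIcc_of_le hℓ.le, integrableOn_Icc_iff_integrableOn_Ioc]
        exact (intervalIntegrable_iff_integrableOn_Ioc_of_le hℓ.le).1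
          (v₂.intervalIntegrable ⟨hℓ.le, le_rfl⟩))
    rw [Set.uIcc_of_le hℓ.le] at this
    exact (continuousOn_const.add this).congr hi₁
  obtain ⟨hc, hd⟩ := primitive_regularity hℓ.le (g := g) hc₁ fun x hx => by
    rw [hi x hx, integral_congr_L2per hg₁ hx]
  have hv₂ : v₂ =ᵐ[volume.restrict (Set.Ioc 0 ℓ)] fun x => (c - W x) * g x - r x := by
    filter_upwards [he, hg, coeFn_toL2per ℓ hr] with x e₁ e₂ e₃
    simp only [e₃] at e₁
    simp only [e₂] at e₁
    linarith
  obtain ⟨-, hd₁⟩ := primitive_regularity hℓ.le (g := g₁)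
    (((continuous_const.sub hW).continuousOn.mul hc).sub hr.continuousOn) fun x hx => by
    rw [hi₁ x hx, integral_congr_L2per hv₂ hx]
    rfl
  exact ⟨g, g₁, hg, hc, hc₁, hper, hper₁, hd, hd₁⟩

end Representatives

/-! ### Generalized kernels of a graph -/

section Graphs

variable {V : Type*} [AddCommGroup V] [Module ℝ V] {A : Submodule ℝ (V × V)}

theorem mem_kerPow_succ {n : ℕ} {v : V} :
    v ∈ kerPow A (n + 1) ↔ ∃ w, (v, w) ∈ A ∧ w ∈ kerPow A n := by
  simp only [kerPow, Submodule.mem_map, Submodule.mem_inf, Submodule.mem_comap,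
    LinearMap.fst_apply, LinearMap.snd_apply]
  constructor
  · rintro ⟨⟨a, b⟩, h, rfl⟩
    exact ⟨b, h⟩
  · rintro ⟨w, h⟩
    exact ⟨(v, w), h, rfl⟩

theorem mem_opKer {v : V} : v ∈ opKer A ↔ (v, 0) ∈ A := by
  rw [opKer, mem_kerPow_succ]
  simp [kerPow]

theorem mem_compOp {B : Submodule ℝ (V × V)} {v w : V} :
    (v, w) ∈ compOp B A ↔ ∃ y, (v, y) ∈ A ∧ (y, w) ∈ B := Iff.rfl

theorem kerPow_succ_le_of_stable {n : ℕ} (h : kerPow A (n + 1) ≤ kerPow A n) {j : ℕ}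
    (hj : n ≤ j) : kerPow A (j + 1) ≤ kerPow A j := by
  induction j, hj using Nat.le_induction with
  | base => exact h
  | succ j _ ih =>
    intro v hv
    obtain ⟨w, hw, hw'⟩ := mem_kerPow_succ.1 hv
    exact mem_kerPow_succ.2 ⟨w, hw, ih hw'⟩

theorem subsingleton_gker {n : ℕ} (h : kerPow A (n + 1) ≤ kerPow A n) :
    Subsingleton (gker A n) := by
  rw [Submodule.Quotient.subsingleton_iff, Submodule.submoduleOf_eq_top]
  exact h

theorem gkerSpannedBy_of_forall {n : ℕ} {v : V} (hv : v ∈ kerPow A (n + 1))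
    (h : ∀ w ∈ kerPow A (n + 1), ∃ s : ℝ, w - s • v ∈ kerPow A n) : GkerSpannedBy A n v := by
  refine ⟨hv, eq_top_iff.2 fun x _ => ?_⟩
  obtain ⟨⟨w, hw⟩, rfl⟩ := Submodule.mkQ_surjective _ x
  obtain ⟨s, hs⟩ := h w hw
  refine Submodule.mem_span_singleton.2 ⟨s, ?_⟩
  rw [← map_smul, ← sub_eq_zero, ← map_sub, ← LinearMap.mem_ker, Submodule.ker_mkQ,
    ← neg_mem_iff, neg_sub]
  exact hs

theorem finrank_gker_eq_one {n : ℕ} {v : V} (h : GkerSpannedBy A n v) (hv : v ∉ kerPow A n) :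
    Module.finrank ℝ (gker A n) = 1 := by
  obtain ⟨hv', hspan⟩ := h
  rw [← finrank_top, ← hspan]
  refine finrank_span_singleton fun h0 => hv ?_
  rw [← LinearMap.mem_ker, Submodule.ker_mkQ] at h0
  exact h0

end Graphs

/-! ### Solutions of the equation of variations -/

/-- The general solution `A u_x + u_v` of the equation of variations. -/
noncomputable def mode (u : Param → ℝ → ℝ) (p : Param) (A : ℝ) (v : Param) (x : ℝ) : ℝ :=
  A * deriv (u p) x + uParam u v p x

/-- The primitive `C + A u + ∫₀ˣ u_v` of `mode u p A v`. -/
noncomputable def modePrimitive (u : Param → ℝ → ℝ) (p : Param) (C A : ℝ) (v : Param) (x : ℝ) : ℝ :=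
  C + A * u p x + ∫ t in (0 : ℝ)..x, uParam u v p t

namespace IsPeriodicWaveFamily

variable {f F : ℝ → ℝ} {Ω : Set Param} {u : Param → ℝ → ℝ}

theorem uParam_add (hu : IsPeriodicWaveFamily f F Ω u) {p : Param} (hp : p ∈ Ω) (v w : Param)
    (x : ℝ) : uParam u (v + w) p x = uParam u v p x + uParam u w p x := by
  simp only [uParam, (hu.differentiableAt_param hp x).lineDeriv_eq_fderiv, map_add]

theorem uParam_smul (hu : IsPeriodicWaveFamily f F Ω u) {p : Param} (hp : p ∈ Ω) (s : ℝ)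
    (v : Param) (x : ℝ) : uParam u (s • v) p x = s * uParam u v p x := by
  simp only [uParam, (hu.differentiableAt_param hp x).lineDeriv_eq_fderiv, map_smul, smul_eq_mul]

theorem uParam_zero (hu : IsPeriodicWaveFamily f F Ω u) {p : Param} (hp : p ∈ Ω) (x : ℝ) :
    uParam u 0 p x = 0 := by
  simp only [uParam, (hu.differentiableAt_param hp x).lineDeriv_eq_fderiv, map_zero]

theorem hasDerivAt_mode (hu : IsPeriodicWaveFamily f F Ω u) (hf : ContDiff ℝ 2 f) {p : Param}
    (hp : p ∈ Ω) (A : ℝ) (v : Param) (x : ℝ) :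
    HasDerivAt (mode u p A v) (A * deriv (deriv (u p)) x + deriv (uParam u v p) x) x :=
  ((hu.hasDerivAt_deriv hp x).differentiableAt.hasDerivAt.const_mul A).add
    (hu.hasDerivAt_uParam hf hp v x).differentiableAt.hasDerivAt

theorem hasDerivAt_deriv_mode (hu : IsPeriodicWaveFamily f F Ω u) (hf : ContDiff ℝ 2 f)
    {p : Param} (hp : p ∈ Ω) (A : ℝ) (v : Param) (x : ℝ) :
    HasDerivAt (fun x => A * deriv (deriv (u p)) x + deriv (uParam u v p) x)
      ((p.2.2 - deriv f (u p x)) * mode u p A v x + (v.1 + v.2.2 * u p x)) x := by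
  refine (((hu.hasDerivAt_deriv_deriv hf hp x).const_mul A).add
    (hu.hasDerivAt_deriv_uParam hf hp v x)).congr_deriv ?_
  rw [mode]
  ring

theorem continuous_mode (hu : IsPeriodicWaveFamily f F Ω u) {p : Param} (hp : p ∈ Ω) (A : ℝ)
    (v : Param) : Continuous (mode u p A v) :=
  ((hu.continuous_deriv hp).const_mul A).add (hu.continuous_uParam hp v)

theorem hasDerivAt_modePrimitive (hu : IsPeriodicWaveFamily f F Ω u) {p : Param} (hp : p ∈ Ω)
    (C A : ℝ) (v : Param) (x : ℝ) : HasDerivAt (modePrimitive u p C A v) (mode u p A v x) x :=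
  (((hu.hasDerivAt hp x).const_mul A).const_add C).add
    ((hu.continuous_uParam hp v).integral_hasStrictDerivAt 0 x).hasDerivAt

theorem continuous_modePrimitive (hu : IsPeriodicWaveFamily f F Ω u) {p : Param} (hp : p ∈ Ω)
    (C A : ℝ) (v : Param) : Continuous (modePrimitive u p C A v) :=
  continuous_iff_continuousAt.2 fun x => (hu.hasDerivAt_modePrimitive hp C A v x).continuousAt

/-- The Hessian of the classical action is symmetric: with `T`, `M`, `P / 2` as its partial
derivatives in `E`, `a`, `c`, its mixed second derivatives agree. This is Green's identity for the
solutions `u_v`, `u_w` over one period. -/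
theorem action_hessian_symm (hu : IsPeriodicWaveFamily f F Ω u) (hf : ContDiff ℝ 2 f)
    (hF : ∀ y, HasDerivAt F (f y) y) {p : Param} (hp : p ∈ Ω) (v w : Param) :
    w.1 * lineDeriv ℝ (mass u) p v + w.2.1 * lineDeriv ℝ (period u) p v +
        w.2.2 * (lineDeriv ℝ (momentum u) p v / 2) =
      v.1 * lineDeriv ℝ (mass u) p w + v.2.1 * lineDeriv ℝ (period u) p w +
        v.2.2 * (lineDeriv ℝ (momentum u) p w / 2) := by
  set T := period u p with hT
  have hV := fun v x => (hu.hasDerivAt_uParam hf hp v x).differentiableAt.hasDerivAt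
  have hV' := hu.hasDerivAt_deriv_uParam hf hp
  have hc := hu.continuous hp
  have hcv := hu.continuous_uParam hp
  have hD : ∀ x, HasDerivAt (fun x => uParam u v p x * deriv (uParam u w p) x -
      uParam u w p x * deriv (uParam u v p) x)
      ((w.1 * uParam u v p x + w.2.2 * (u p x * uParam u v p x)) -
        (v.1 * uParam u w p x + v.2.2 * (u p x * uParam u w p x))) x := fun x =>
    (((hV v x).mul (hV' w x)).sub ((hV w x).mul (hV' v x))).congr_deriv (by ring)
  have hi : ∀ v w : Param, IntervalIntegrable (fun x => w.1 * uParam u v p x +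
      w.2.2 * (u p x * uParam u v p x)) volume 0 T := fun v w => by
    have := hcv v
    exact Continuous.intervalIntegrable (by fun_prop) _ _
  have hval : ∀ v w : Param, ∫ x in (0 : ℝ)..T, (w.1 * uParam u v p x +
      w.2.2 * (u p x * uParam u v p x)) =
      w.1 * (lineDeriv ℝ (mass u) p v - lineDeriv ℝ (period u) p v * u p 0) +
      w.2.2 * ((lineDeriv ℝ (momentum u) p v - lineDeriv ℝ (period u) p v * u p 0 ^ 2) / 2) := by
    intro v w
    have := hcv v
    rw [intervalIntegral.integral_add (Continuous.intervalIntegrable (by fun_prop) _ _)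
      (Continuous.intervalIntegrable (by fun_prop) _ _), intervalIntegral.integral_const_mul,
      intervalIntegral.integral_const_mul, hT, hu.integral_uParam hf hp,
      hu.integral_mul_uParam hf hp]
  have hgreen := intervalIntegral.integral_eq_sub_of_hasDerivAt (a := 0) (b := T)
    (fun x _ => hD x) ((hi v w).sub (hi w v))
  rw [intervalIntegral.integral_sub (hi v w) (hi w v), hval, hval] at hgreen
  have hVT : ∀ v, uParam u v p T = uParam u v p 0 - lineDeriv ℝ (period u) p v * deriv (u p) 0 :=
    fun v => by simpa using hu.uParam_add_period hf hp v 0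
  have hVT' : ∀ v, deriv (uParam u v p) T = deriv (uParam u v p) 0 -
      lineDeriv ℝ (period u) p v * deriv (deriv (u p)) 0 := fun v => by
    have h1 := (hV v (0 + T)).comp_add_const 0 T
    rw [funext (hu.uParam_add_period hf hp v)] at h1
    have h2 := (hV v 0).sub ((hu.hasDerivAt_deriv hp 0).differentiableAt.hasDerivAt.const_mul
      (lineDeriv ℝ (period u) p v))
    simpa using h1.unique h2
  rw [hVT, hVT, hVT', hVT'] at hgreen
  have e₁ := hu.wronskian_uParam hf hF hp v 0
  have e₂ := hu.wronskian_uParam hf hF hp w 0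
  linear_combination hgreen + lineDeriv ℝ (period u) p w * e₁ - lineDeriv ℝ (period u) p v * e₂

theorem deriv_deriv_add_period (hu : IsPeriodicWaveFamily f F Ω u) {p : Param} (hp : p ∈ Ω) :
    Function.Periodic (deriv (deriv (u p))) (period u p) := by
  intro x
  rw [hu.profile p hp, hu.profile p hp, hu.periodic_period hp]

theorem mode_add_nat_mul_period (hu : IsPeriodicWaveFamily f F Ω u) (hf : ContDiff ℝ 2 f)
    {p : Param} (hp : p ∈ Ω) (A : ℝ) (v : Param) (k : ℕ) (x : ℝ) :
    mode u p A v (x + k * period u p) =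
      mode u p A v x - k * lineDeriv ℝ (period u) p v * deriv (u p) x := by
  induction k with
  | zero => simp
  | succ k ih =>
    have h1 : x + ((k + 1 : ℕ) : ℝ) * period u p = (x + k * period u p) + period u p := by
      push_cast; ring
    have h2 := (hu.deriv_add_period hp).nat_mul k x
    rw [mode, mode] at ih
    rw [h1, mode, mode, hu.deriv_add_period hp, hu.uParam_add_period hf hp, h2]
    rw [h2] at ih
    push_cast
    linarith

theorem deriv_mode_add_nat_mul_period (hu : IsPeriodicWaveFamily f F Ω u) (hf : ContDiff ℝ 2 f)
    {p : Param} (hp : p ∈ Ω) (A : ℝ) (v : Param) (k : ℕ) (x : ℝ) :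
    A * deriv (deriv (u p)) (x + k * period u p) + deriv (uParam u v p) (x + k * period u p) =
      A * deriv (deriv (u p)) x + deriv (uParam u v p) x -
        k * lineDeriv ℝ (period u) p v * deriv (deriv (u p)) x := by
  have h1 := (hu.hasDerivAt_mode hf hp A v (x + k * period u p)).comp_add_const x (k * period u p)
  rw [funext (hu.mode_add_nat_mul_period hf hp A v k)] at h1
  have h2 := (hu.hasDerivAt_mode hf hp A v x).sub
    ((hu.hasDerivAt_deriv hp x).differentiableAt.hasDerivAt.const_mul
      (k * lineDeriv ℝ (period u) p v))
  exact h1.unique h2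

/-- `u_v` is periodic in the directions `v` in which the period is stationary. -/
theorem periodic_uParam (hu : IsPeriodicWaveFamily f F Ω u) (hf : ContDiff ℝ 2 f)
    {p : Param} (hp : p ∈ Ω) {v : Param} (hv : lineDeriv ℝ (period u) p v = 0) :
    Function.Periodic (uParam u v p) (period u p) := fun x => by
  rw [hu.uParam_add_period hf hp, hv]; ring

theorem _root_.Function.Periodic.intervalIntegral_zero_nat_mul {g : ℝ → ℝ} {T : ℝ}
    (hg : Function.Periodic g T) (hc : Continuous g) (k : ℕ) :
    ∫ x in (0 : ℝ)..k * T, g x = k * ∫ x in (0 : ℝ)..T, g x := by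
  have := hg.intervalIntegral_add_zsmul_eq (k : ℤ) 0 fun _ _ => hc.intervalIntegrable _ _
  simpa using this

theorem modePrimitive_nat_mul_period (hu : IsPeriodicWaveFamily f F Ω u) (hf : ContDiff ℝ 2 f)
    {p : Param} (hp : p ∈ Ω) (C A : ℝ) {v : Param} (hv : lineDeriv ℝ (period u) p v = 0) (k : ℕ) :
    modePrimitive u p C A v (k * period u p) =
      modePrimitive u p C A v 0 + k * lineDeriv ℝ (mass u) p v := by
  have h := (hu.periodic_period hp).nat_mul k 0
  rw [zero_add] at h
  simp only [modePrimitive, h, (hu.periodic_uParam hf hp hv).intervalIntegral_zero_nat_mul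
    (hu.continuous_uParam hp v), hu.integral_uParam hf hp, hv, intervalIntegral.integral_same]
  ring

/-- The functions `u_x`, `u_a`, `u_E`, `u_c` are linearly independent on `(0, ℓ)`. -/
theorem mode_eq_zero (hu : IsPeriodicWaveFamily f F Ω u) (hf : ContDiff ℝ 2 f)
    (hF : ∀ y, HasDerivAt F (f y) y) {p : Param} (hp : p ∈ Ω) {A : ℝ} {v : Param} {ℓ : ℝ}
    (hℓ : 0 < ℓ) (h : ∀ x ∈ Set.Ioo 0 ℓ, mode u p A v x = 0) : A = 0 ∧ v = 0 := by
  have hzero : ∀ {g g' : ℝ → ℝ}, (∀ x, HasDerivAt g (g' x) x) → (∀ x ∈ Set.Ioo 0 ℓ, g x = 0) →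
      ∀ x ∈ Set.Ioo 0 ℓ, g' x = 0 := by
    intro g g' hg h0 x hx
    refine (hg x).unique ((hasDerivAt_const x (0 : ℝ)).congr_of_eventuallyEq ?_)
    filter_upwards [Ioo_mem_nhds hx.1 hx.2] with y hy
    exact h0 y hy
  have hm : ℓ / 2 ∈ Set.Ioo 0 ℓ := ⟨by linarith, by linarith⟩
  have hE := hu.wronskian_uParam hf hF hp dirE (ℓ / 2)
  simp only [dirE, zero_mul, add_zero] at hE
  have h1 := hzero (hu.hasDerivAt_mode hf hp A v) h
  have h2 : ∀ x ∈ Set.Ioo 0 ℓ, v.1 + v.2.2 * u p x = 0 := by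
    intro x hx
    have := hzero (hu.hasDerivAt_deriv_mode hf hp A v) h1 x hx
    rw [h x hx] at this
    linarith
  have h3 := hzero (fun x => ((hu.hasDerivAt hp x).const_mul v.2.2).const_add v.1) h2
  have h4 := hzero (fun x =>
    ((hu.hasDerivAt_deriv hp x).differentiableAt.hasDerivAt.const_mul v.2.2)) h3
  have hv3 : v.2.2 = 0 := by
    linear_combination deriv (uParam u (0, 1, 0) p) (ℓ / 2) * h3 _ hm -
      uParam u (0, 1, 0) p (ℓ / 2) * h4 _ hm - v.2.2 * hE
  have hv1 : v.1 = 0 := by simpa [hv3] using h2 _ hm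
  have hv2 : v.2.1 = 0 := by
    have hw := hu.wronskian_uParam hf hF hp v (ℓ / 2)
    have e0 := h _ hm
    rw [mode] at e0
    have e1 := h1 _ hm
    rw [hv1, hv3] at hw
    linear_combination deriv (u p) (ℓ / 2) * e1 - deriv (deriv (u p)) (ℓ / 2) * e0 - hw
  have hv : v = 0 := Prod.ext hv1 (Prod.ext hv2 hv3)
  subst hv
  refine ⟨?_, rfl⟩
  have e0 := h _ hm
  have e1 := h1 _ hm
  have h00 : uParam u 0 p = fun _ => 0 := funext (hu.uParam_zero hp)
  simp only [mode, h00, deriv_const, add_zero] at e0 e1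
  linear_combination deriv (uParam u (0, 1, 0) p) (ℓ / 2) * e0 -
      uParam u (0, 1, 0) p (ℓ / 2) * e1 - A * hE

theorem modePrimitive_eq_zero (hu : IsPeriodicWaveFamily f F Ω u) (hf : ContDiff ℝ 2 f)
    (hF : ∀ y, HasDerivAt F (f y) y) {p : Param} (hp : p ∈ Ω) {C A : ℝ} {v : Param} {ℓ : ℝ}
    (hℓ : 0 < ℓ) (h : ∀ x ∈ Set.Ioo 0 ℓ, modePrimitive u p C A v x = 0) :
    C = 0 ∧ A = 0 ∧ v = 0 := by
  obtain ⟨rfl, rfl⟩ := hu.mode_eq_zero hf hF hp (A := A) (v := v) hℓ fun x hx => by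
    refine (hu.hasDerivAt_modePrimitive hp C A v x).unique
      ((hasDerivAt_const x (0 : ℝ)).congr_of_eventuallyEq ?_)
    filter_upwards [Ioo_mem_nhds hx.1 hx.2] with y hy
    exact h y hy
  refine ⟨?_, rfl, rfl⟩
  have := h (ℓ / 2) ⟨by linarith, by linarith⟩
  simpa [modePrimitive, hu.uParam_zero hp] using this

/-! ### The operators on classes of modes -/

section Classes

variable {p : Param} {k : ℕ}

theorem length_pos (hu : IsPeriodicWaveFamily f F Ω u) (hp : p ∈ Ω) (hk : 1 ≤ k) :
    0 < k * period u p :=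
  mul_pos (by exact_mod_cast hk) (hu.period_pos hp)

theorem continuous_potential (hu : IsPeriodicWaveFamily f F Ω u) (hf : ContDiff ℝ 2 f)
    (hp : p ∈ Ω) : Continuous fun x => deriv f (u p x) :=
  (hf.continuous_deriv one_le_two).comp (hu.continuous hp)

/-- The range of `𝓛` is orthogonal to `u_x`, as `𝓛` is symmetric and annihilates `u_x`. -/
theorem integral_mul_deriv_eq_zero (hu : IsPeriodicWaveFamily f F Ω u) (hf : ContDiff ℝ 2 f)
    (hp : p ∈ Ω) (hk : 1 ≤ k) {r : ℝ → ℝ} (hr : Continuous r) {w : L2per (k * period u p)}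
    (h : (w, cls u p k r) ∈ opL u f p k) :
    ∫ x in (0 : ℝ)..k * period u p, r x * deriv (u p) x = 0 := by
  have hℓ := hu.length_pos hp hk
  obtain ⟨g, g₁, -, hc, hc₁, hper, hper₁, hd, hd₁⟩ :=
    exists_classical_of_mem_schrodingerOp hℓ (hu.continuous_potential hf hp) hr h
  have hux := hu.continuous_deriv hp
  have huxx : Continuous (deriv (deriv (u p))) :=
    continuous_iff_continuousAt.2 fun x => (hu.hasDerivAt_deriv_deriv hf hp x).continuousAt
  have hW := intervalIntegral.integral_eq_sub_of_hasDerivAt_of_le hℓ.le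
    (f := fun x => deriv (deriv (u p)) x * g x - deriv (u p) x * g₁ x)
    (f' := fun x => r x * deriv (u p) x)
    ((huxx.continuousOn.mul hc).sub (hux.continuousOn.mul hc₁)) (fun x hx =>
      (((hu.hasDerivAt_deriv_deriv hf hp x).mul (hd x hx)).sub
        ((hu.hasDerivAt_deriv hp x).differentiableAt.hasDerivAt.mul (hd₁ x hx))).congr_deriv
        (by ring)) ((hr.mul hux).intervalIntegrable _ _)
  have e₁ := (hu.deriv_add_period hp).nat_mul k 0
  have e₂ := (hu.deriv_deriv_add_period hp).nat_mul k 0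
  rw [zero_add] at e₁ e₂
  rw [hW, hper, hper₁, e₁, e₂]
  ring

/-- The solutions of `𝓛 w = C + A u` are the modes `α u_x + u_v` for the directions `v` with
`v_a = -C`, `v_c = -A` in which the period is stationary. -/
theorem mem_opL_iff (hu : IsPeriodicWaveFamily f F Ω u) (hf : ContDiff ℝ 2 f)
    (hF : ∀ y, HasDerivAt F (f y) y) (hp : p ∈ Ω) (hk : 1 ≤ k) {C A : ℝ}
    {w : L2per (k * period u p)} :
    (w, cls u p k (modePrimitive u p C A 0)) ∈ opL u f p k ↔
      ∃ α v, v.1 = -C ∧ v.2.2 = -A ∧ lineDeriv ℝ (period u) p v = 0 ∧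
        w = cls u p k (mode u p α v) := by
  have hℓ := hu.length_pos hp hk
  have hr := hu.continuous_modePrimitive hp C A 0
  have hrx : ∀ x, modePrimitive u p C A 0 x = C + A * u p x := fun x => by
    simp [modePrimitive, hu.uParam_zero hp]
  constructor
  · intro h
    obtain ⟨g, g₁, hwg, hc, hc₁, hper, hper₁, hd, hd₁⟩ :=
      exists_classical_of_mem_schrodingerOp hℓ (hu.continuous_potential hf hp) hr h
    set ℓ := k * period u p with hℓdef
    set v₀ : Param := (-C, 0, -A) with hv₀
    set y := uParam u v₀ p
    set y₁ := deriv (uParam u v₀ p)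
    have hy : ∀ x, HasDerivAt y (y₁ x) x := fun x =>
      (hu.hasDerivAt_uParam hf hp v₀ x).differentiableAt.hasDerivAt
    have hy₁ : ∀ x, HasDerivAt y₁ _ x := hu.hasDerivAt_deriv_uParam hf hp v₀
    set e := uParam u dirE p
    set e₁ := deriv (uParam u dirE p)
    have he : ∀ x, HasDerivAt e (e₁ x) x := fun x =>
      (hu.hasDerivAt_uParam hf hp dirE x).differentiableAt.hasDerivAt
    have he₁ : ∀ x, HasDerivAt e₁ _ x := hu.hasDerivAt_deriv_uParam hf hp dirE
    set ux := deriv (u p)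
    set uxx := deriv (deriv (u p))
    have hux : ∀ x, HasDerivAt ux (uxx x) x := fun x =>
      (hu.hasDerivAt_deriv hp x).differentiableAt.hasDerivAt
    have huxx : ∀ x, HasDerivAt uxx _ x := hu.hasDerivAt_deriv_deriv hf hp
    have hcont : ∀ {g g' : ℝ → ℝ}, (∀ x, HasDerivAt g (g' x) x) →
        ContinuousOn g (Set.Icc 0 ℓ) := fun hg x _ => (hg x).continuousAt.continuousWithinAt
    have hE : ∀ x, ux x * e₁ x - uxx x * e x = 1 := fun x =>
      (hu.wronskian_uParam hf hF hp dirE x).trans (by simp [dirE])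
    -- the Wronskians of the homogeneous solution `g - u_{v₀}` with `u_x` and `u_E` are constant
    have hconst : ∀ {D : ℝ → ℝ}, ContinuousOn D (Set.Icc 0 ℓ) →
        (∀ x ∈ Set.Ioo 0 ℓ, HasDerivAt D 0 x) → ∀ x ∈ Set.Icc 0 ℓ, D x = D 0 := by
      intro D hD hD' x hx
      rcases eq_or_lt_of_le hx.1 with rfl | hx0
      · rfl
      · obtain ⟨z, hz, hz'⟩ := exists_hasDerivAt_eq_slope D (fun _ => 0) hx0
          (hD.mono (Set.Icc_subset_Icc_right hx.2))
          (fun z hz => hD' z ⟨hz.1, hz.2.trans_le hx.2⟩)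
        rw [eq_comm, div_eq_zero_iff] at hz'
        rcases hz' with h | h <;> linarith
    have hcg := hc.sub (hcont hy)
    have hcg₁ := hc₁.sub (hcont hy₁)
    have hB := hconst (D := fun x => ux x * (g₁ x - y₁ x) - uxx x * (g x - y x))
      (((hcont hux).mul hcg₁).sub ((hcont huxx).mul hcg)) fun x hx =>
      (((hux x).mul ((hd₁ x hx).sub (hy₁ x))).sub
        ((huxx x).mul ((hd x hx).sub (hy x)))).congr_deriv (by
          simp only [hrx, hv₀, y, Pi.sub_apply]; ring)
    have hA := hconst (D := fun x => (g x - y x) * e₁ x - (g₁ x - y₁ x) * e x)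
      ((hcg.mul (hcont he₁)).sub (hcg₁.mul (hcont he))) fun x hx =>
      ((((hd x hx).sub (hy x)).mul (he₁ x)).sub
        (((hd₁ x hx).sub (hy₁ x)).mul (he x))).congr_deriv (by
          simp only [hrx, hv₀, y, dirE, e, Pi.sub_apply]; ring)
    set β := ux 0 * (g₁ 0 - y₁ 0) - uxx 0 * (g 0 - y 0)
    set α := (g 0 - y 0) * e₁ 0 - (g₁ 0 - y₁ 0) * e 0
    set v : Param := v₀ + β • dirE with hv
    have hVv : ∀ x, uParam u v p x = y x + β * e x := fun x => by
      rw [hv, hu.uParam_add hp, hu.uParam_smul hp]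
    have hVv' : ∀ x, deriv (uParam u v p) x = y₁ x + β * e₁ x := fun x => by
      rw [funext hVv]
      exact ((hy x).add ((he x).const_mul β)).deriv
    have hg : ∀ x ∈ Set.Icc 0 ℓ, g x = mode u p α v x := fun x hx => by
      rw [mode, hVv]
      linear_combination ux x * hA x hx + e x * hB x hx - (g x - y x) * hE x
    have hg₁ : ∀ x ∈ Set.Icc 0 ℓ, g₁ x = α * uxx x + deriv (uParam u v p) x := fun x hx => by
      rw [hVv']
      linear_combination uxx x * hA x hx + e₁ x * hB x hx - (g₁ x - y₁ x) * hE x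
    have h0 : (0 : ℝ) ∈ Set.Icc 0 ℓ := ⟨le_rfl, hℓ.le⟩
    have h1 : ℓ ∈ Set.Icc 0 ℓ := ⟨hℓ.le, le_rfl⟩
    refine ⟨α, v, by simp [hv, hv₀, dirE], by simp [hv, hv₀, dirE], ?_,
      eq_toL2per hwg (hu.continuous_mode hp α v) fun x hx => hg x (Set.Ioc_subset_Icc_self hx)⟩
    have p₀ := hu.mode_add_nat_mul_period hf hp α v k 0
    have p₁ := hu.deriv_mode_add_nat_mul_period hf hp α v k 0
    rw [zero_add, ← hℓdef, ← hg _ h0, ← hg _ h1, hper] at p₀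
    rw [zero_add, ← hℓdef, ← hg₁ _ h0, ← hg₁ _ h1, hper₁] at p₁
    have hkT : k * lineDeriv ℝ (period u) p v = 0 := by
      linear_combination e₁ 0 * p₀ - e 0 * p₁ - (k * lineDeriv ℝ (period u) p v) * hE 0
    exact (mul_eq_zero.1 hkT).resolve_left (by positivity)
  · rintro ⟨α, v, h1, h2, hT, rfl⟩
    have p₀ := hu.mode_add_nat_mul_period hf hp α v k 0
    have p₁ := hu.deriv_mode_add_nat_mul_period hf hp α v k 0
    refine mem_schrodingerOp_of_hasDerivAt (hu.continuous_potential hf hp) hr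
      (hu.hasDerivAt_mode hf hp α v)
      (fun x => (hu.hasDerivAt_deriv_mode hf hp α v x).congr_deriv ?_) ?_ ?_
    · rw [hrx, h1, h2]; ring
    · simpa [hT] using p₀
    · simpa [hT] using p₁

/-- The solutions of `∂ₓ y = A u_x + u_v` are the primitives of the right side, and exist only if
the mass is stationary in the direction `v`. -/
theorem mem_derivOp_mode_iff (hu : IsPeriodicWaveFamily f F Ω u) (hf : ContDiff ℝ 2 f)
    (hp : p ∈ Ω) (hk : 1 ≤ k) {A : ℝ} {v : Param} (hv : lineDeriv ℝ (period u) p v = 0)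
    {y : L2per (k * period u p)} :
    (y, cls u p k (mode u p A v)) ∈ derivOp (k * period u p) ↔
      lineDeriv ℝ (mass u) p v = 0 ∧ ∃ C, y = cls u p k (modePrimitive u p C A v) := by
  rw [mem_derivOp_toL2per_iff (hu.length_pos hp hk) (hu.hasDerivAt_modePrimitive hp 0 A v)
    (hu.continuous_mode hp A v), hu.modePrimitive_nat_mul_period hf hp _ _ hv]
  have hC : ∀ C, (fun x => C + modePrimitive u p 0 A v x) = modePrimitive u p C A v := fun C => by
    funext x
    simp only [modePrimitive]
    ring
  simp only [hC]
  refine and_congr_left fun _ => ?_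
  rw [add_eq_left, mul_eq_zero]
  exact or_iff_right (by positivity)

/-- Solvability of `𝓛 w = C + A u + ∫₀ˣ u_v` requires the momentum to be stationary in the
direction `v`. -/
theorem momentum_stationary_of_mem_opL (hu : IsPeriodicWaveFamily f F Ω u) (hf : ContDiff ℝ 2 f)
    (hp : p ∈ Ω) (hk : 1 ≤ k) {C A : ℝ} {v : Param} (hv : lineDeriv ℝ (period u) p v = 0)
    (hv' : lineDeriv ℝ (mass u) p v = 0) {w : L2per (k * period u p)}
    (h : (w, cls u p k (modePrimitive u p C A v)) ∈ opL u f p k) :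
    lineDeriv ℝ (momentum u) p v = 0 := by
  have hint := hu.integral_mul_deriv_eq_zero hf hp hk (hu.continuous_modePrimitive hp C A v) h
  have hc := hu.continuous hp
  have hcx := hu.continuous_deriv hp
  have hcv := hu.continuous_uParam hp v
  have hcm := hu.continuous_mode hp A v
  have hparts := intervalIntegral.integral_mul_deriv_eq_deriv_mul (a := 0) (b := k * period u p)
    (fun x _ => hu.hasDerivAt_modePrimitive hp C A v x) (fun x _ => hu.hasDerivAt hp x)
    (hcm.intervalIntegrable _ _) (hcx.intervalIntegrable _ _)
  have hend := hu.modePrimitive_nat_mul_period hf hp C A hv k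
  have huT := (hu.periodic_period hp).nat_mul k 0
  rw [zero_add] at huT
  have hsq : ∫ x in (0 : ℝ)..k * period u p, A * (u p x * deriv (u p) x) = 0 := by
    have : ∀ x, HasDerivAt (fun x => A * (u p x ^ 2 / 2)) (A * (u p x * deriv (u p) x)) x := by
      intro x
      refine ((((hu.hasDerivAt hp x).pow 2).div_const 2).const_mul A).congr_deriv ?_
      rw [show 2 - 1 = 1 from rfl]
      push_cast
      ring
    rw [intervalIntegral.integral_eq_sub_of_hasDerivAt (fun x _ => this x)
      (Continuous.intervalIntegrable (by fun_prop) _ _), huT]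
    ring
  have huv : ∫ x in (0 : ℝ)..k * period u p, u p x * uParam u v p x =
      k * (lineDeriv ℝ (momentum u) p v / 2) := by
    have hpv : Function.Periodic (fun x => u p x * uParam u v p x) (period u p) :=
      (hu.periodic_period hp).mul (hu.periodic_uParam hf hp hv)
    rw [hpv.intervalIntegral_zero_nat_mul (hc.mul hcv), hu.integral_mul_uParam hf hp, hv]
    ring
  have hsplit : ∫ x in (0 : ℝ)..k * period u p, mode u p A v x * u p x =
      (∫ x in (0 : ℝ)..k * period u p, A * (u p x * deriv (u p) x)) +
        ∫ x in (0 : ℝ)..k * period u p, u p x * uParam u v p x := by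
    rw [← intervalIntegral.integral_add (Continuous.intervalIntegrable (by fun_prop) _ _)
      (Continuous.intervalIntegrable (by fun_prop) _ _)]
    refine intervalIntegral.integral_congr fun x _ => ?_
    simp only [mode]
    ring
  rw [hint, hsplit, hsq, huv, hend, huT, hv'] at hparts
  have hk0 : (k : ℝ) ≠ 0 := by positivity
  have : (k : ℝ) * lineDeriv ℝ (momentum u) p v = 0 := by linarith
  exact (mul_eq_zero.1 this).resolve_left hk0

theorem cls_mode_zero (hu : IsPeriodicWaveFamily f F Ω u) (hp : p ∈ Ω) :
    cls u p k (mode u p 0 0) = 0 := by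
  rw [← toL2per_zero]
  congr 1
  funext x
  simp [mode, hu.uParam_zero hp]

theorem cls_modePrimitive_zero (hu : IsPeriodicWaveFamily f F Ω u) (hp : p ∈ Ω) :
    cls u p k (modePrimitive u p 0 0 0) = 0 := by
  rw [← toL2per_zero]
  congr 1
  funext x
  simp [modePrimitive, hu.uParam_zero hp]

theorem cls_mode_combination (hu : IsPeriodicWaveFamily f F Ω u) (hp : p ∈ Ω) (s t A B : ℝ)
    (v w : Param) :
    s • cls u p k (mode u p A v) + t • cls u p k (mode u p B w) =
      cls u p k (mode u p (s * A + t * B) (s • v + t • w)) := by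
  rw [← toL2per_combination _ s t (hu.continuous_mode hp A v) (hu.continuous_mode hp B w)]
  congr 1
  funext x
  simp only [mode, hu.uParam_add hp, hu.uParam_smul hp]
  ring

theorem cls_modePrimitive_combination (hu : IsPeriodicWaveFamily f F Ω u) (hp : p ∈ Ω)
    (s t C D A B : ℝ) (v w : Param) :
    s • cls u p k (modePrimitive u p C A v) + t • cls u p k (modePrimitive u p D B w) =
      cls u p k (modePrimitive u p (s * C + t * D) (s * A + t * B) (s • v + t • w)) := by
  rw [← toL2per_combination _ s t (hu.continuous_modePrimitive hp C A v)
    (hu.continuous_modePrimitive hp D B w)]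
  congr 1
  funext x
  have hv := (hu.continuous_uParam hp v).intervalIntegrable (μ := volume) 0 x
  have hw := (hu.continuous_uParam hp w).intervalIntegrable (μ := volume) 0 x
  simp only [modePrimitive, hu.uParam_add hp, hu.uParam_smul hp]
  rw [intervalIntegral.integral_add (hv.const_mul s) (hw.const_mul t),
    intervalIntegral.integral_const_mul, intervalIntegral.integral_const_mul]
  ring

theorem eq_zero_of_cls_mode (hu : IsPeriodicWaveFamily f F Ω u) (hf : ContDiff ℝ 2 f)
    (hF : ∀ y, HasDerivAt F (f y) y) (hp : p ∈ Ω) (hk : 1 ≤ k) {A : ℝ} {v : Param}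
    (h : cls u p k (mode u p A v) = 0) : A = 0 ∧ v = 0 :=
  hu.mode_eq_zero hf hF hp (hu.length_pos hp hk) fun _ hx =>
    eqOn_zero_of_toL2per_eq_zero (hu.length_pos hp hk) (hu.continuous_mode hp A v) h
      (Set.Ioo_subset_Icc_self hx)

theorem eq_zero_of_cls_modePrimitive (hu : IsPeriodicWaveFamily f F Ω u) (hf : ContDiff ℝ 2 f)
    (hF : ∀ y, HasDerivAt F (f y) y) (hp : p ∈ Ω) (hk : 1 ≤ k) {C A : ℝ} {v : Param}
    (h : cls u p k (modePrimitive u p C A v) = 0) : C = 0 ∧ A = 0 ∧ v = 0 :=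
  hu.modePrimitive_eq_zero hf hF hp (hu.length_pos hp hk) fun _ hx =>
    eqOn_zero_of_toL2per_eq_zero (hu.length_pos hp hk) (hu.continuous_modePrimitive hp C A v) h
      (Set.Ioo_subset_Icc_self hx)

end Classes

end IsPeriodicWaveFamily

/-! ### Kernels and generalized kernels in coordinates -/

theorem lineDeriv_eq_coordinates {G : Param → ℝ} {p : Param} (hG : DifferentiableAt ℝ G p)
    (v : Param) : lineDeriv ℝ G p v =
      v.1 * lineDeriv ℝ G p dirA + v.2.1 * lineDeriv ℝ G p dirE +
        v.2.2 * lineDeriv ℝ G p dirC := by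
  simp only [hG.lineDeriv_eq_fderiv]
  have hv : v = v.1 • dirA + v.2.1 • dirE + v.2.2 • dirC := by
    ext <;> simp [dirA, dirE, dirC]
  conv_lhs => rw [hv]
  simp only [map_add, map_smul, smul_eq_mul]

/-- The cross product `∇M × ∇T` of the gradients of the mass and the period. Its components are the
cofactors in the determinant `φ₂`. -/
noncomputable def gradCross (u : Param → ℝ → ℝ) (p : Param) : Param :=
  (lineDeriv ℝ (mass u) p dirE * lineDeriv ℝ (period u) p dirC -
      lineDeriv ℝ (period u) p dirE * lineDeriv ℝ (mass u) p dirC,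
    lineDeriv ℝ (period u) p dirA * lineDeriv ℝ (mass u) p dirC -
      lineDeriv ℝ (mass u) p dirA * lineDeriv ℝ (period u) p dirC,
    lineDeriv ℝ (period u) p dirE * lineDeriv ℝ (mass u) p dirA -
      lineDeriv ℝ (mass u) p dirE * lineDeriv ℝ (period u) p dirA)

namespace IsPeriodicWaveFamily

variable {f F : ℝ → ℝ} {Ω : Set Param} {u : Param → ℝ → ℝ} {p : Param} {k : ℕ}

theorem phi1_eq (hu : IsPeriodicWaveFamily f F Ω u) (hp : p ∈ Ω) :
    phi1 u p = mode u p 0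
      (-lineDeriv ℝ (period u) p dirE, lineDeriv ℝ (period u) p dirA, 0) := by
  funext x
  have hv : ((-lineDeriv ℝ (period u) p dirE, lineDeriv ℝ (period u) p dirA, 0) : Param) =
      (-lineDeriv ℝ (period u) p dirE) • dirA + lineDeriv ℝ (period u) p dirA • dirE := by
    ext <;> simp [dirA, dirE]
  rw [mode, hv, hu.uParam_add hp, hu.uParam_smul hp, hu.uParam_smul hp, phi1,
    Matrix.det_fin_two_of]
  ring

theorem phi2_eq (hu : IsPeriodicWaveFamily f F Ω u) (hp : p ∈ Ω) :
    phi2 u p = uParam u (gradCross u p) p := by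
  funext x
  have hv : gradCross u p = (gradCross u p).1 • dirA + (gradCross u p).2.1 • dirE +
      (gradCross u p).2.2 • dirC := by
    ext <;> simp [dirA, dirE, dirC]
  rw [hv, hu.uParam_add hp, hu.uParam_add hp, hu.uParam_smul hp, hu.uParam_smul hp,
    hu.uParam_smul hp, phi2, Matrix.det_fin_three]
  simp [gradCross]
  ring

theorem cls_deriv (hu : IsPeriodicWaveFamily f F Ω u) (hp : p ∈ Ω) :
    cls u p k (deriv (u p)) = cls u p k (mode u p 1 0) := by
  congr 1; funext x; simp [mode, hu.uParam_zero hp]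

theorem cls_uParam (v : Param) : cls u p k (uParam u v p) = cls u p k (mode u p 0 v) := by
  congr 1; funext x; simp [mode]

theorem cls_one (hu : IsPeriodicWaveFamily f F Ω u) (hp : p ∈ Ω) :
    cls u p k (fun _ => 1) = cls u p k (modePrimitive u p 1 0 0) := by
  congr 1; funext x; simp [modePrimitive, hu.uParam_zero hp]

theorem cls_profile (hu : IsPeriodicWaveFamily f F Ω u) (hp : p ∈ Ω) :
    cls u p k (u p) = cls u p k (modePrimitive u p 0 1 0) := by
  congr 1; funext x; simp [modePrimitive, hu.uParam_zero hp]

theorem cls_integral_uParam (v : Param) :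
    cls u p k (fun x => ∫ t in (0 : ℝ)..x, uParam u v p t) =
      cls u p k (modePrimitive u p 0 0 v) := by
  congr 1; funext x; simp [modePrimitive]

theorem mass_dirE (hu : IsPeriodicWaveFamily f F Ω u) (hf : ContDiff ℝ 2 f)
    (hF : ∀ y, HasDerivAt F (f y) y) (hp : p ∈ Ω) :
    lineDeriv ℝ (mass u) p dirE = lineDeriv ℝ (period u) p dirA := by
  have := hu.action_hessian_symm hf hF hp dirE dirA
  simp only [dirA, dirE] at this ⊢
  linarith

theorem momentum_dirE (hu : IsPeriodicWaveFamily f F Ω u) (hf : ContDiff ℝ 2 f)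
    (hF : ∀ y, HasDerivAt F (f y) y) (hp : p ∈ Ω) :
    lineDeriv ℝ (momentum u) p dirE = 2 * lineDeriv ℝ (period u) p dirC := by
  have := hu.action_hessian_symm hf hF hp dirE dirC
  simp only [dirC, dirE] at this ⊢
  linarith

theorem momentum_dirA (hu : IsPeriodicWaveFamily f F Ω u) (hf : ContDiff ℝ 2 f)
    (hF : ∀ y, HasDerivAt F (f y) y) (hp : p ∈ Ω) :
    lineDeriv ℝ (momentum u) p dirA = 2 * lineDeriv ℝ (mass u) p dirC := by
  have := hu.action_hessian_symm hf hF hp dirA dirC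
  simp only [dirC, dirA] at this ⊢
  linarith

/-! ### The operator `𝓛` -/

theorem mem_opKer_opL_iff (hu : IsPeriodicWaveFamily f F Ω u) (hf : ContDiff ℝ 2 f)
    (hF : ∀ y, HasDerivAt F (f y) y) (hp : p ∈ Ω) (hk : 1 ≤ k) {w : L2per (k * period u p)} :
    w ∈ opKer (opL u f p k) ↔ ∃ A y, y * lineDeriv ℝ (period u) p dirE = 0 ∧
      w = cls u p k (mode u p A (0, y, 0)) := by
  have hT := lineDeriv_eq_coordinates (hu.differentiableAt_period hf hp)
  rw [mem_opKer, ← hu.cls_modePrimitive_zero hp, hu.mem_opL_iff hf hF hp hk]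
  simp only [neg_zero]
  constructor
  · rintro ⟨A, ⟨x, y, z⟩, rfl, rfl, hv, rfl⟩
    rw [hT] at hv
    exact ⟨A, y, by simpa using hv, rfl⟩
  · rintro ⟨A, y, hv, rfl⟩
    exact ⟨A, (0, y, 0), rfl, rfl, by rw [hT]; simpa using hv, rfl⟩

/-! ### The operator `∂ₓ𝓛` -/

/-- Every solution of `∂ₓ𝓛 w = A u_x + u_v` forces the mass and the momentum to be stationary in the
direction `v`; once `v = 0` the solutions are modes. -/
theorem of_mem_opDL (hu : IsPeriodicWaveFamily f F Ω u) (hf : ContDiff ℝ 2 f)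
    (hF : ∀ y, HasDerivAt F (f y) y) (hp : p ∈ Ω) (hk : 1 ≤ k) {A : ℝ} {v : Param}
    (hv : lineDeriv ℝ (period u) p v = 0) {w : L2per (k * period u p)}
    (h : (w, cls u p k (mode u p A v)) ∈ opDL u f p k) :
    lineDeriv ℝ (mass u) p v = 0 ∧ lineDeriv ℝ (momentum u) p v = 0 ∧
      (v = 0 → ∃ B v', v'.2.2 = -A ∧ lineDeriv ℝ (period u) p v' = 0 ∧
        w = cls u p k (mode u p B v')) := by
  obtain ⟨y, h₁, h₂⟩ := mem_compOp.1 h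
  obtain ⟨hM, C, rfl⟩ := (hu.mem_derivOp_mode_iff hf hp hk hv).1 h₂
  refine ⟨hM, hu.momentum_stationary_of_mem_opL hf hp hk hv hM h₁, ?_⟩
  rintro rfl
  obtain ⟨B, v', -, h₃, h₄, h₅⟩ := (hu.mem_opL_iff hf hF hp hk).1 h₁
  exact ⟨B, v', h₃, h₄, h₅⟩

theorem mem_opDL (hu : IsPeriodicWaveFamily f F Ω u) (hf : ContDiff ℝ 2 f)
    (hF : ∀ y, HasDerivAt F (f y) y) (hp : p ∈ Ω) (hk : 1 ≤ k) (A : ℝ) {v : Param}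
    (hv : lineDeriv ℝ (period u) p v = 0) :
    (cls u p k (mode u p A v), cls u p k (mode u p (-v.2.2) 0)) ∈ opDL u f p k := by
  refine mem_compOp.2 ⟨cls u p k (modePrimitive u p (-v.1) (-v.2.2) 0),
    (hu.mem_opL_iff hf hF hp hk).2 ⟨A, v, by simp, by simp, hv, rfl⟩, ?_⟩
  exact (hu.mem_derivOp_mode_iff hf hp hk lineDeriv_zero).2 ⟨lineDeriv_zero, _, rfl⟩

theorem mem_opKer_opDL_iff (hu : IsPeriodicWaveFamily f F Ω u) (hf : ContDiff ℝ 2 f)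
    (hF : ∀ y, HasDerivAt F (f y) y) (hp : p ∈ Ω) (hk : 1 ≤ k) {w : L2per (k * period u p)} :
    w ∈ opKer (opDL u f p k) ↔
      ∃ A x y, x * lineDeriv ℝ (period u) p dirA + y * lineDeriv ℝ (period u) p dirE = 0 ∧
        w = cls u p k (mode u p A (x, y, 0)) := by
  have hT := lineDeriv_eq_coordinates (hu.differentiableAt_period hf hp)
  rw [mem_opKer, ← hu.cls_mode_zero hp]
  constructor
  · intro h
    obtain ⟨A, ⟨x, y, z⟩, hz, hv, rfl⟩ :=
      (hu.of_mem_opDL hf hF hp hk lineDeriv_zero h).2.2 rfl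
    simp only [neg_zero] at hz
    subst hz
    rw [hT] at hv
    exact ⟨A, x, y, by simpa using hv, rfl⟩
  · rintro ⟨A, x, y, hv, rfl⟩
    simpa using hu.mem_opDL hf hF hp hk A (v := (x, y, 0)) (by rw [hT]; simpa using hv)

theorem mem_kerPow_two_opDL_of_stationary (hu : IsPeriodicWaveFamily f F Ω u)
    (hf : ContDiff ℝ 2 f) (hF : ∀ y, HasDerivAt F (f y) y) (hp : p ∈ Ω) (hk : 1 ≤ k) (A : ℝ)
    {v : Param} (hv : lineDeriv ℝ (period u) p v = 0) :
    cls u p k (mode u p A v) ∈ kerPow (opDL u f p k) 2 :=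
  mem_kerPow_succ.2 ⟨_, hu.mem_opDL hf hF hp hk A hv,
    (hu.mem_opKer_opDL_iff hf hF hp hk).2 ⟨-v.2.2, 0, 0, by simp, rfl⟩⟩

theorem mem_kerPow_two_opDL_iff (hu : IsPeriodicWaveFamily f F Ω u) (hf : ContDiff ℝ 2 f)
    (hF : ∀ y, HasDerivAt F (f y) y) (hp : p ∈ Ω) (hk : 1 ≤ k)
    (hnd : ∀ v : Param, v.2.2 = 0 → lineDeriv ℝ (period u) p v = 0 →
      lineDeriv ℝ (mass u) p v = 0 → lineDeriv ℝ (momentum u) p v = 0 → v = 0)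
    {w : L2per (k * period u p)} :
    w ∈ kerPow (opDL u f p k) 2 ↔
      ∃ A v, lineDeriv ℝ (period u) p v = 0 ∧ w = cls u p k (mode u p A v) := by
  constructor
  · intro h
    obtain ⟨z, hz, hz'⟩ := mem_kerPow_succ.1 h
    obtain ⟨A, x, y, hxy, rfl⟩ := (hu.mem_opKer_opDL_iff hf hF hp hk).1 hz'
    have hv : lineDeriv ℝ (period u) p (x, y, 0) = 0 := by
      rw [lineDeriv_eq_coordinates (hu.differentiableAt_period hf hp)]
      simpa using hxy
    obtain ⟨hM, hP, hex⟩ := hu.of_mem_opDL hf hF hp hk hv hz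
    obtain ⟨B, v', -, hv', rfl⟩ := hex (hnd _ rfl hv hM hP)
    exact ⟨B, v', hv', rfl⟩
  · rintro ⟨A, v, hv, rfl⟩
    exact hu.mem_kerPow_two_opDL_of_stationary hf hF hp hk A hv

theorem kerPow_opDL_stable (hu : IsPeriodicWaveFamily f F Ω u) (hf : ContDiff ℝ 2 f)
    (hF : ∀ y, HasDerivAt F (f y) y) (hp : p ∈ Ω) (hk : 1 ≤ k)
    (hnd : ∀ v : Param, lineDeriv ℝ (period u) p v = 0 →
      lineDeriv ℝ (mass u) p v = 0 → lineDeriv ℝ (momentum u) p v = 0 → v = 0) :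
    kerPow (opDL u f p k) 3 ≤ kerPow (opDL u f p k) 2 := by
  intro w hw
  obtain ⟨z, hz, hz'⟩ := mem_kerPow_succ.1 hw
  obtain ⟨A, v, hv, rfl⟩ := (hu.mem_kerPow_two_opDL_iff hf hF hp hk fun v _ => hnd v).1 hz'
  obtain ⟨hM, hP, hex⟩ := hu.of_mem_opDL hf hF hp hk hv hz
  obtain ⟨B, v', -, hv', rfl⟩ := hex (hnd _ hv hM hP)
  exact hu.mem_kerPow_two_opDL_of_stationary hf hF hp hk B hv'

/-- If `T`, `M` and `P` are jointly stationary in no direction of the `(a, E)`-plane, then a mode in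
a direction `n` with `n_c ≠ 0` in which the period is stationary spans the first generalized kernel
of `∂ₓ𝓛`. -/
theorem gkerSpannedBy_opDL (hu : IsPeriodicWaveFamily f F Ω u) (hf : ContDiff ℝ 2 f)
    (hF : ∀ y, HasDerivAt F (f y) y) (hp : p ∈ Ω) (hk : 1 ≤ k)
    (hnd : ∀ v : Param, v.2.2 = 0 → lineDeriv ℝ (period u) p v = 0 →
      lineDeriv ℝ (mass u) p v = 0 → lineDeriv ℝ (momentum u) p v = 0 → v = 0)
    {n : Param} (hn : lineDeriv ℝ (period u) p n = 0) (hn' : n.2.2 ≠ 0) :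
    GkerSpannedBy (opDL u f p k) 1 (cls u p k (mode u p 0 n)) ∧
      cls u p k (mode u p 0 n) ∉ kerPow (opDL u f p k) 1 := by
  have hT := lineDeriv_eq_coordinates (hu.differentiableAt_period hf hp)
  refine ⟨gkerSpannedBy_of_forall (hu.mem_kerPow_two_opDL_of_stationary hf hF hp hk 0 hn)
    fun w hw => ?_, fun h => ?_⟩
  · obtain ⟨A, v, hv, rfl⟩ := (hu.mem_kerPow_two_opDL_iff hf hF hp hk hnd).1 hw
    refine ⟨v.2.2 / n.2.2, ?_⟩
    have hcomb := hu.cls_mode_combination (k := k) hp 1 (-(v.2.2 / n.2.2)) A 0 v n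
    rw [one_smul, neg_smul, ← sub_eq_add_neg] at hcomb
    rw [hcomb]
    refine (hu.mem_opKer_opDL_iff hf hF hp hk).2
      ⟨A, v.1 - v.2.2 / n.2.2 * n.1, v.2.1 - v.2.2 / n.2.2 * n.2.1, ?_, ?_⟩
    · rw [hT] at hn hv
      have : v.2.2 / n.2.2 * n.2.2 = v.2.2 := div_mul_cancel₀ _ hn'
      linear_combination hv - v.2.2 / n.2.2 * hn + lineDeriv ℝ (period u) p dirC * this
    · congr 2
      · ring
      · ext <;> simp [hn'] <;> ring
  · obtain ⟨A, x, y, -, hxy⟩ := (hu.mem_opKer_opDL_iff hf hF hp hk).1 h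
    have hcomb := hu.cls_mode_combination (k := k) hp 1 (-1) 0 A n (x, y, 0)
    rw [one_smul, neg_smul, one_smul, ← sub_eq_add_neg, hxy, sub_self] at hcomb
    have h0 := (hu.eq_zero_of_cls_mode hf hF hp hk hcomb.symm).2
    exact hn' (by simpa using congrArg (fun v : Param => v.2.2) h0)

/-! ### The operator `𝓛∂ₓ` -/

/-- Every solution of `𝓛∂ₓ w = C + A u + ∫₀ˣ u_v` forces the momentum to be stationary in the
direction `v`; once `v = 0` the solutions are primitives of modes. -/
theorem of_mem_opLD (hu : IsPeriodicWaveFamily f F Ω u) (hf : ContDiff ℝ 2 f)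
    (hF : ∀ y, HasDerivAt F (f y) y) (hp : p ∈ Ω) (hk : 1 ≤ k) {C A : ℝ} {v : Param}
    (hv : lineDeriv ℝ (period u) p v = 0) (hM : lineDeriv ℝ (mass u) p v = 0)
    {w : L2per (k * period u p)}
    (h : (w, cls u p k (modePrimitive u p C A v)) ∈ opLD u f p k) :
    lineDeriv ℝ (momentum u) p v = 0 ∧
      (v = 0 → ∃ D B v', v'.1 = -C ∧ v'.2.2 = -A ∧ lineDeriv ℝ (period u) p v' = 0 ∧
        lineDeriv ℝ (mass u) p v' = 0 ∧ w = cls u p k (modePrimitive u p D B v')) := by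
  obtain ⟨y, h₁, h₂⟩ := mem_compOp.1 h
  refine ⟨hu.momentum_stationary_of_mem_opL hf hp hk hv hM h₂, ?_⟩
  rintro rfl
  obtain ⟨B, v', hv₁, hv₂, hT, rfl⟩ := (hu.mem_opL_iff hf hF hp hk).1 h₂
  obtain ⟨hM', D, rfl⟩ := (hu.mem_derivOp_mode_iff hf hp hk hT).1 h₁
  exact ⟨D, B, v', hv₁, hv₂, hT, hM', rfl⟩

theorem mem_opLD (hu : IsPeriodicWaveFamily f F Ω u) (hf : ContDiff ℝ 2 f)
    (hF : ∀ y, HasDerivAt F (f y) y) (hp : p ∈ Ω) (hk : 1 ≤ k) (C A : ℝ) {v : Param}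
    (hv : lineDeriv ℝ (period u) p v = 0) (hM : lineDeriv ℝ (mass u) p v = 0) :
    (cls u p k (modePrimitive u p C A v),
      cls u p k (modePrimitive u p (-v.1) (-v.2.2) 0)) ∈ opLD u f p k :=
  mem_compOp.2 ⟨cls u p k (mode u p A v), (hu.mem_derivOp_mode_iff hf hp hk hv).2 ⟨hM, C, rfl⟩,
    (hu.mem_opL_iff hf hF hp hk).2 ⟨A, v, by simp, by simp, hv, rfl⟩⟩

theorem mem_opKer_opLD_iff (hu : IsPeriodicWaveFamily f F Ω u) (hf : ContDiff ℝ 2 f)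
    (hF : ∀ y, HasDerivAt F (f y) y) (hp : p ∈ Ω) (hk : 1 ≤ k) {w : L2per (k * period u p)} :
    w ∈ opKer (opLD u f p k) ↔ ∃ C A y, y * lineDeriv ℝ (period u) p dirE = 0 ∧
      y * lineDeriv ℝ (period u) p dirA = 0 ∧
        w = cls u p k (modePrimitive u p C A (0, y, 0)) := by
  have hT := lineDeriv_eq_coordinates (hu.differentiableAt_period hf hp)
  have hM := lineDeriv_eq_coordinates (hu.differentiableAt_mass hf hp)
  rw [mem_opKer, ← hu.cls_modePrimitive_zero hp]
  constructor
  · intro h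
    obtain ⟨C, A, ⟨x, y, z⟩, hx, hz, hv, hv', rfl⟩ :=
      (hu.of_mem_opLD hf hF hp hk lineDeriv_zero lineDeriv_zero h).2 rfl
    simp only [neg_zero] at hx hz
    subst hx hz
    rw [hT] at hv
    rw [hM, hu.mass_dirE hf hF hp] at hv'
    exact ⟨C, A, y, by simpa using hv, by simpa using hv', rfl⟩
  · rintro ⟨C, A, y, hv, hv', rfl⟩
    simpa using hu.mem_opLD hf hF hp hk C A (v := (0, y, 0)) (by rw [hT]; simpa using hv)
      (by rw [hM, hu.mass_dirE hf hF hp]; simpa using hv')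

theorem mem_kerPow_two_opLD_of_stationary (hu : IsPeriodicWaveFamily f F Ω u)
    (hf : ContDiff ℝ 2 f) (hF : ∀ y, HasDerivAt F (f y) y) (hp : p ∈ Ω) (hk : 1 ≤ k) (C A : ℝ)
    {v : Param} (hv : lineDeriv ℝ (period u) p v = 0) (hM : lineDeriv ℝ (mass u) p v = 0) :
    cls u p k (modePrimitive u p C A v) ∈ kerPow (opLD u f p k) 2 :=
  mem_kerPow_succ.2 ⟨_, hu.mem_opLD hf hF hp hk C A hv hM,
    (hu.mem_opKer_opLD_iff hf hF hp hk).2 ⟨-v.1, -v.2.2, 0, by simp, by simp, rfl⟩⟩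

theorem mem_kerPow_two_opLD_iff (hu : IsPeriodicWaveFamily f F Ω u) (hf : ContDiff ℝ 2 f)
    (hF : ∀ y, HasDerivAt F (f y) y) (hp : p ∈ Ω) (hk : 1 ≤ k)
    (hnd : ¬(lineDeriv ℝ (period u) p dirE = 0 ∧ lineDeriv ℝ (period u) p dirA = 0))
    {w : L2per (k * period u p)} :
    w ∈ kerPow (opLD u f p k) 2 ↔
      ∃ C A v, lineDeriv ℝ (period u) p v = 0 ∧ lineDeriv ℝ (mass u) p v = 0 ∧
        w = cls u p k (modePrimitive u p C A v) := by
  constructor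
  · intro h
    obtain ⟨z, hz, hz'⟩ := mem_kerPow_succ.1 h
    obtain ⟨C, A, y, hy, hy', rfl⟩ := (hu.mem_opKer_opLD_iff hf hF hp hk).1 hz'
    obtain rfl : y = 0 := by
      by_contra hy0
      exact hnd ⟨(mul_eq_zero.1 hy).resolve_left hy0, (mul_eq_zero.1 hy').resolve_left hy0⟩
    obtain ⟨D, B, v', -, -, hv', hM', rfl⟩ :=
      (hu.of_mem_opLD hf hF hp hk lineDeriv_zero lineDeriv_zero hz).2 rfl
    exact ⟨D, B, v', hv', hM', rfl⟩
  · rintro ⟨C, A, v, hv, hv', rfl⟩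
    exact hu.mem_kerPow_two_opLD_of_stationary hf hF hp hk C A hv hv'

theorem kerPow_opLD_stable (hu : IsPeriodicWaveFamily f F Ω u) (hf : ContDiff ℝ 2 f)
    (hF : ∀ y, HasDerivAt F (f y) y) (hp : p ∈ Ω) (hk : 1 ≤ k)
    (hnd : ¬(lineDeriv ℝ (period u) p dirE = 0 ∧ lineDeriv ℝ (period u) p dirA = 0))
    (hnd' : ∀ v : Param, lineDeriv ℝ (period u) p v = 0 →
      lineDeriv ℝ (mass u) p v = 0 → lineDeriv ℝ (momentum u) p v = 0 → v = 0) :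
    kerPow (opLD u f p k) 3 ≤ kerPow (opLD u f p k) 2 := by
  intro w hw
  obtain ⟨z, hz, hz'⟩ := mem_kerPow_succ.1 hw
  obtain ⟨C, A, v, hv, hM, rfl⟩ := (hu.mem_kerPow_two_opLD_iff hf hF hp hk hnd).1 hz'
  obtain ⟨hP, hex⟩ := hu.of_mem_opLD hf hF hp hk hv hM hz
  obtain ⟨D, B, v', -, -, hv', hM', rfl⟩ := hex (hnd' _ hv hM hP)
  exact hu.mem_kerPow_two_opLD_of_stationary hf hF hp hk D B hv' hM'

theorem period_gradCross (hu : IsPeriodicWaveFamily f F Ω u) (hf : ContDiff ℝ 2 f) (hp : p ∈ Ω) :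
    lineDeriv ℝ (period u) p (gradCross u p) = 0 := by
  rw [lineDeriv_eq_coordinates (hu.differentiableAt_period hf hp), gradCross]
  ring

theorem mass_gradCross (hu : IsPeriodicWaveFamily f F Ω u) (hf : ContDiff ℝ 2 f) (hp : p ∈ Ω) :
    lineDeriv ℝ (mass u) p (gradCross u p) = 0 := by
  rw [lineDeriv_eq_coordinates (hu.differentiableAt_mass hf hp), gradCross]
  ring

/-- A direction in which the period and the mass are both stationary is a multiple of the cross
product of their gradients. -/
theorem eq_smul_gradCross (hu : IsPeriodicWaveFamily f F Ω u) (hf : ContDiff ℝ 2 f) (hp : p ∈ Ω)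
    (hn : (gradCross u p).1 ≠ 0 ∨ (gradCross u p).2.2 ≠ 0) {v : Param}
    (hv : lineDeriv ℝ (period u) p v = 0) (hM : lineDeriv ℝ (mass u) p v = 0) :
    ∃ s : ℝ, v = s • gradCross u p := by
  rw [lineDeriv_eq_coordinates (hu.differentiableAt_period hf hp)] at hv
  rw [lineDeriv_eq_coordinates (hu.differentiableAt_mass hf hp)] at hM
  obtain ⟨x, y, z⟩ := v
  simp only [gradCross] at hn hv hM ⊢
  generalize lineDeriv ℝ (period u) p dirA = Ta at *
  generalize lineDeriv ℝ (period u) p dirE = Te at *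
  generalize lineDeriv ℝ (period u) p dirC = Tc at *
  generalize lineDeriv ℝ (mass u) p dirA = Ma at *
  generalize lineDeriv ℝ (mass u) p dirE = Me at *
  generalize lineDeriv ℝ (mass u) p dirC = Mc at *
  rcases hn with hn | hn
  · refine ⟨x / (Me * Tc - Te * Mc), Prod.ext ?_ (Prod.ext ?_ ?_)⟩ <;>
      simp only [Prod.smul_mk, smul_eq_mul] <;> field_simp
    · linear_combination Tc * hM - Mc * hv
    · linear_combination Me * hv - Te * hM
  · refine ⟨z / (Te * Ma - Me * Ta), Prod.ext ?_ (Prod.ext ?_ ?_)⟩ <;>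
      simp only [Prod.smul_mk, smul_eq_mul] <;> field_simp
    · linear_combination Te * hM - Me * hv
    · linear_combination Ma * hv - Ta * hM

/-- The first generalized kernel of `𝓛∂ₓ` corresponds to the directions in which `T` and `M` are
both stationary. These form the line spanned by `gradCross u p` once the gradients of `T` and `M`
are independent; by `gradCross_ne_zero` this already holds if `{T, M}` or `{T, P}` is nonzero. -/
theorem gkerSpannedBy_opLD (hu : IsPeriodicWaveFamily f F Ω u) (hf : ContDiff ℝ 2 f)
    (hF : ∀ y, HasDerivAt F (f y) y) (hp : p ∈ Ω) (hk : 1 ≤ k)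
    (hnd : ¬(lineDeriv ℝ (period u) p dirE = 0 ∧ lineDeriv ℝ (period u) p dirA = 0))
    (hn : (gradCross u p).1 ≠ 0 ∨ (gradCross u p).2.2 ≠ 0) :
    GkerSpannedBy (opLD u f p k) 1 (cls u p k (modePrimitive u p 0 0 (gradCross u p))) ∧
      cls u p k (modePrimitive u p 0 0 (gradCross u p)) ∉ kerPow (opLD u f p k) 1 := by
  have hTn := hu.period_gradCross hf hp
  have hMn := hu.mass_gradCross hf hp
  refine ⟨gkerSpannedBy_of_forall (hu.mem_kerPow_two_opLD_of_stationary hf hF hp hk 0 0 hTn hMn)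
    fun w hw => ?_, fun h => ?_⟩
  · obtain ⟨C, A, v, hv, hM, rfl⟩ := (hu.mem_kerPow_two_opLD_iff hf hF hp hk hnd).1 hw
    obtain ⟨s, rfl⟩ := hu.eq_smul_gradCross hf hp hn hv hM
    refine ⟨s, (hu.mem_opKer_opLD_iff hf hF hp hk).2 ⟨C, A, 0, by simp, by simp, ?_⟩⟩
    have hcomb := hu.cls_modePrimitive_combination (k := k) hp 1 (-s) C 0 A 0
      (s • gradCross u p) (gradCross u p)
    rw [one_smul, neg_smul, ← sub_eq_add_neg] at hcomb
    rw [hcomb]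
    congr 2
    · ring
    · ring
    · rw [one_smul, neg_smul, add_neg_cancel]
      rfl
  · obtain ⟨C, A, y, hy, hy', hxy⟩ := (hu.mem_opKer_opLD_iff hf hF hp hk).1 h
    obtain rfl : y = 0 := by
      by_contra hy0
      exact hnd ⟨(mul_eq_zero.1 hy).resolve_left hy0, (mul_eq_zero.1 hy').resolve_left hy0⟩
    have hcomb := hu.cls_modePrimitive_combination (k := k) hp 1 (-1) 0 C 0 A (gradCross u p)
      (0, 0, 0)
    rw [one_smul, neg_smul, one_smul, ← sub_eq_add_neg, hxy, sub_self] at hcomb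
    have h0 := (hu.eq_zero_of_cls_modePrimitive hf hF hp hk hcomb.symm).2.2
    rcases hn with hn | hn
    · exact hn (by simpa using congrArg (fun v : Param => v.1) h0)
    · exact hn (by simpa using congrArg (fun v : Param => v.2.2) h0)

end IsPeriodicWaveFamily

/-! ### Spans and dimensions -/

namespace IsPeriodicWaveFamily

variable {f F : ℝ → ℝ} {Ω : Set Param} {u : Param → ℝ → ℝ} {p : Param} {k : ℕ}

theorem opKer_opL_eq_span_of_ne (hu : IsPeriodicWaveFamily f F Ω u) (hf : ContDiff ℝ 2 f)
    (hF : ∀ y, HasDerivAt F (f y) y) (hp : p ∈ Ω) (hk : 1 ≤ k)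
    (hE : lineDeriv ℝ (period u) p dirE ≠ 0) :
    opKer (opL u f p k) = Submodule.span ℝ {cls u p k (deriv (u p))} := by
  ext w
  rw [hu.mem_opKer_opL_iff hf hF hp hk, Submodule.mem_span_singleton, hu.cls_deriv hp]
  have hsmul : ∀ A : ℝ, A • cls u p k (mode u p 1 0) = cls u p k (mode u p A (0, 0, 0)) := by
    intro A
    have := hu.cls_mode_combination (k := k) hp A 0 1 0 0 0
    rw [zero_smul, add_zero] at this
    rw [this]
    congr 2
    · ring
    · simp only [smul_zero, add_zero]
      rfl
  constructor
  · rintro ⟨A, y, hy, rfl⟩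
    obtain rfl : y = 0 := (mul_eq_zero.1 hy).resolve_right hE
    exact ⟨A, hsmul A⟩
  · rintro ⟨A, rfl⟩
    exact ⟨A, 0, by simp, hsmul A⟩

theorem opKer_opL_eq_span_of_eq (hu : IsPeriodicWaveFamily f F Ω u) (hf : ContDiff ℝ 2 f)
    (hF : ∀ y, HasDerivAt F (f y) y) (hp : p ∈ Ω) (hk : 1 ≤ k)
    (hE : lineDeriv ℝ (period u) p dirE = 0) :
    opKer (opL u f p k) =
      Submodule.span ℝ {cls u p k (deriv (u p)), cls u p k (uParam u dirE p)} := by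
  ext w
  rw [hu.mem_opKer_opL_iff hf hF hp hk, Submodule.mem_span_pair, hu.cls_deriv hp, cls_uParam]
  have hcomb : ∀ A y : ℝ, A • cls u p k (mode u p 1 0) + y • cls u p k (mode u p 0 dirE) =
      cls u p k (mode u p A (0, y, 0)) := by
    intro A y
    rw [hu.cls_mode_combination hp]
    congr 2
    · ring
    · ext <;> simp [dirE]
  constructor
  · rintro ⟨A, y, -, rfl⟩
    exact ⟨A, y, hcomb A y⟩
  · rintro ⟨A, y, rfl⟩
    exact ⟨A, y, by rw [hE, mul_zero], (hcomb A y).symm ▸ rfl⟩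

theorem opKer_opDL_eq_span_of_not (hu : IsPeriodicWaveFamily f F Ω u) (hf : ContDiff ℝ 2 f)
    (hF : ∀ y, HasDerivAt F (f y) y) (hp : p ∈ Ω) (hk : 1 ≤ k)
    (hnd : ¬(lineDeriv ℝ (period u) p dirE = 0 ∧ lineDeriv ℝ (period u) p dirA = 0)) :
    opKer (opDL u f p k) =
      Submodule.span ℝ {cls u p k (deriv (u p)), cls u p k (phi1 u p)} := by
  ext w
  rw [hu.mem_opKer_opDL_iff hf hF hp hk, Submodule.mem_span_pair, hu.cls_deriv hp,
    hu.phi1_eq hp]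
  set TE := lineDeriv ℝ (period u) p dirE
  set TA := lineDeriv ℝ (period u) p dirA
  have hcomb : ∀ A s : ℝ, A • cls u p k (mode u p 1 0) + s • cls u p k (mode u p 0 (-TE, TA, 0)) =
      cls u p k (mode u p A (s * -TE, s * TA, 0)) := by
    intro A s
    rw [hu.cls_mode_combination hp]
    congr 2
    · ring
    · ext <;> simp
  constructor
  · rintro ⟨A, x, y, hxy, rfl⟩
    have hs : ∃ s, x = s * -TE ∧ y = s * TA := by
      by_cases hE : TE = 0
      · have hA : TA ≠ 0 := fun h => hnd ⟨hE, h⟩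
        have hx : x = 0 := by simpa [hE, hA] using hxy
        exact ⟨y / TA, by simp [hE, hx], by field_simp⟩
      · refine ⟨-x / TE, by field_simp, ?_⟩
        field_simp
        linear_combination hxy
    obtain ⟨s, rfl, rfl⟩ := hs
    exact ⟨A, s, hcomb A s⟩
  · rintro ⟨A, s, rfl⟩
    exact ⟨A, s * -TE, s * TA, by ring, hcomb A s⟩

theorem opKer_opLD_eq_span_of_not (hu : IsPeriodicWaveFamily f F Ω u) (hf : ContDiff ℝ 2 f)
    (hF : ∀ y, HasDerivAt F (f y) y) (hp : p ∈ Ω) (hk : 1 ≤ k)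
    (hnd : ¬(lineDeriv ℝ (period u) p dirE = 0 ∧ lineDeriv ℝ (period u) p dirA = 0)) :
    opKer (opLD u f p k) =
      Submodule.span ℝ {cls u p k (fun _ => 1), cls u p k (u p)} := by
  ext w
  rw [hu.mem_opKer_opLD_iff hf hF hp hk, Submodule.mem_span_pair, hu.cls_one hp,
    hu.cls_profile hp]
  have hcomb : ∀ C A : ℝ, C • cls u p k (modePrimitive u p 1 0 0) +
      A • cls u p k (modePrimitive u p 0 1 0) = cls u p k (modePrimitive u p C A (0, 0, 0)) := by
    intro C A
    rw [hu.cls_modePrimitive_combination hp]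
    congr 2
    · ring
    · ring
    · simp only [smul_zero, add_zero]
      rfl
  constructor
  · rintro ⟨C, A, y, hy, hy', rfl⟩
    obtain rfl : y = 0 := by
      by_contra hy0
      exact hnd ⟨(mul_eq_zero.1 hy).resolve_left hy0, (mul_eq_zero.1 hy').resolve_left hy0⟩
    exact ⟨C, A, hcomb C A⟩
  · rintro ⟨C, A, rfl⟩
    exact ⟨C, A, 0, by simp, by simp, hcomb C A⟩

theorem opKer_opDL_eq_span_of_stationary (hu : IsPeriodicWaveFamily f F Ω u)
    (hf : ContDiff ℝ 2 f) (hF : ∀ y, HasDerivAt F (f y) y) (hp : p ∈ Ω) (hk : 1 ≤ k)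
    (hE : lineDeriv ℝ (period u) p dirE = 0) (hA : lineDeriv ℝ (period u) p dirA = 0) :
    opKer (opDL u f p k) = Submodule.span ℝ {cls u p k (deriv (u p)),
      cls u p k (uParam u dirA p), cls u p k (uParam u dirE p)} := by
  ext w
  rw [hu.mem_opKer_opDL_iff hf hF hp hk, Submodule.mem_span_triple, hu.cls_deriv hp,
    cls_uParam, cls_uParam]
  have hcomb : ∀ A x y : ℝ, A • cls u p k (mode u p 1 0) + x • cls u p k (mode u p 0 dirA) +
      y • cls u p k (mode u p 0 dirE) = cls u p k (mode u p A (x, y, 0)) := by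
    intro A x y
    rw [hu.cls_mode_combination hp, ← one_smul ℝ (cls u p k (mode u p _ _)),
      hu.cls_mode_combination hp]
    congr 2
    · ring
    · ext <;> simp [dirA, dirE]
  constructor
  · rintro ⟨A, x, y, -, rfl⟩
    exact ⟨A, x, y, hcomb A x y⟩
  · rintro ⟨A, x, y, rfl⟩
    exact ⟨A, x, y, by rw [hE, hA]; ring, hcomb A x y⟩

theorem opKer_opLD_eq_span_of_stationary (hu : IsPeriodicWaveFamily f F Ω u)
    (hf : ContDiff ℝ 2 f) (hF : ∀ y, HasDerivAt F (f y) y) (hp : p ∈ Ω) (hk : 1 ≤ k)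
    (hE : lineDeriv ℝ (period u) p dirE = 0) (hA : lineDeriv ℝ (period u) p dirA = 0) :
    opKer (opLD u f p k) = Submodule.span ℝ {cls u p k (fun _ => 1), cls u p k (u p),
      cls u p k (fun x => ∫ t in (0 : ℝ)..x, uParam u dirE p t)} := by
  ext w
  rw [hu.mem_opKer_opLD_iff hf hF hp hk, Submodule.mem_span_triple, hu.cls_one hp,
    hu.cls_profile hp, cls_integral_uParam]
  have hcomb : ∀ C A y : ℝ, C • cls u p k (modePrimitive u p 1 0 0) +
      A • cls u p k (modePrimitive u p 0 1 0) + y • cls u p k (modePrimitive u p 0 0 dirE) =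
        cls u p k (modePrimitive u p C A (0, y, 0)) := by
    intro C A y
    rw [hu.cls_modePrimitive_combination hp,
      ← one_smul ℝ (cls u p k (modePrimitive u p _ _ (C • 0 + A • 0))),
      hu.cls_modePrimitive_combination hp]
    congr 2
    · ring
    · ring
    · ext <;> simp [dirE]
  constructor
  · rintro ⟨C, A, y, -, -, rfl⟩
    exact ⟨C, A, y, hcomb C A y⟩
  · rintro ⟨C, A, y, rfl⟩
    exact ⟨C, A, y, by rw [hE, mul_zero], by rw [hA, mul_zero], hcomb C A y⟩

theorem _root_.rank_span_triple_le {V : Type*} [AddCommGroup V] [Module ℝ V] (x y z : V) :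
    Module.rank ℝ (Submodule.span ℝ {x, y, z}) ≤ 3 := by
  classical
  have h := rank_span_finset_le (R := ℝ) ({x, y, z} : Finset V)
  have hc : (({x, y, z} : Finset V).card : Cardinal) ≤ 3 := by
    exact_mod_cast Finset.card_le_three
  rw [show ({x, y, z} : Set V) = (({x, y, z} : Finset V) : Set V) by simp]
  exact h.trans hc

theorem rank_opKer_le (hu : IsPeriodicWaveFamily f F Ω u)
    (hf : ContDiff ℝ 2 f) (hF : ∀ y, HasDerivAt F (f y) y) (hp : p ∈ Ω) (hk : 1 ≤ k) :
    Module.rank ℝ (opKer (opDL u f p k)) ≤ 3 ∧ Module.rank ℝ (opKer (opLD u f p k)) ≤ 3 := by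
  by_cases h : lineDeriv ℝ (period u) p dirE = 0 ∧ lineDeriv ℝ (period u) p dirA = 0
  · rw [hu.opKer_opDL_eq_span_of_stationary hf hF hp hk h.1 h.2,
      hu.opKer_opLD_eq_span_of_stationary hf hF hp hk h.1 h.2]
    exact ⟨rank_span_triple_le _ _ _, rank_span_triple_le _ _ _⟩
  · rw [hu.opKer_opDL_eq_span_of_not hf hF hp hk h, hu.opKer_opLD_eq_span_of_not hf hF hp hk h]
    have h1 := rank_span_triple_le (cls u p k (deriv (u p))) (cls u p k (phi1 u p))
      (cls u p k (phi1 u p))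
    have h2 := rank_span_triple_le (cls u p k (fun _ => 1)) (cls u p k (u p)) (cls u p k (u p))
    rw [Set.pair_eq_singleton] at h1 h2
    exact ⟨h1, h2⟩

theorem finrank_opKer_opL (hu : IsPeriodicWaveFamily f F Ω u) (hf : ContDiff ℝ 2 f)
    (hF : ∀ y, HasDerivAt F (f y) y) (hp : p ∈ Ω) (hk : 1 ≤ k)
    (hE : lineDeriv ℝ (period u) p dirE ≠ 0) : Module.finrank ℝ (opKer (opL u f p k)) = 1 := by
  rw [hu.opKer_opL_eq_span_of_ne hf hF hp hk hE]
  refine finrank_span_singleton fun h => ?_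
  rw [hu.cls_deriv hp] at h
  exact one_ne_zero (hu.eq_zero_of_cls_mode hf hF hp hk h).1

theorem finrank_opKer_opDL (hu : IsPeriodicWaveFamily f F Ω u) (hf : ContDiff ℝ 2 f)
    (hF : ∀ y, HasDerivAt F (f y) y) (hp : p ∈ Ω) (hk : 1 ≤ k)
    (hE : lineDeriv ℝ (period u) p dirE ≠ 0) : Module.finrank ℝ (opKer (opDL u f p k)) = 2 := by
  rw [hu.opKer_opDL_eq_span_of_not hf hF hp hk fun h => hE h.1]
  have hli : LinearIndependent ℝ ![cls u p k (deriv (u p)), cls u p k (phi1 u p)] := by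
    rw [LinearIndependent.pair_iff]
    intro s t hst
    rw [hu.cls_deriv hp, hu.phi1_eq hp, hu.cls_mode_combination hp] at hst
    obtain ⟨h1, h2⟩ := hu.eq_zero_of_cls_mode hf hF hp hk hst
    have h3 := congrArg (fun v : Param => v.1) h2
    exact ⟨by simpa using h1, by simpa [hE] using h3⟩
  have h := finrank_span_eq_card hli
  rw [Matrix.range_cons_cons_empty] at h
  exact h.trans (Fintype.card_fin 2)

/-! ### Nondegeneracy conditions in terms of Jacobians -/

theorem period_nondegenerate
    (h : ¬(jac2 (period u) (mass u) dirA dirE p = 0 ∧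
      jac2 (period u) (momentum u) dirA dirE p = 0)) :
    ¬(lineDeriv ℝ (period u) p dirE = 0 ∧ lineDeriv ℝ (period u) p dirA = 0) := by
  rintro ⟨h1, h2⟩
  refine h ⟨?_, ?_⟩ <;> rw [jac2, Matrix.det_fin_two_of, h1, h2] <;> ring

theorem stationary_eq_zero_of_jac2 (hu : IsPeriodicWaveFamily f F Ω u) (hf : ContDiff ℝ 2 f)
    (hp : p ∈ Ω) (h : ¬(jac2 (period u) (mass u) dirA dirE p = 0 ∧
      jac2 (period u) (momentum u) dirA dirE p = 0))
    (v : Param) (hz : v.2.2 = 0) (hT : lineDeriv ℝ (period u) p v = 0)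
    (hM : lineDeriv ℝ (mass u) p v = 0) (hP : lineDeriv ℝ (momentum u) p v = 0) : v = 0 := by
  rw [lineDeriv_eq_coordinates (hu.differentiableAt_period hf hp)] at hT
  rw [lineDeriv_eq_coordinates (hu.differentiableAt_mass hf hp)] at hM
  rw [lineDeriv_eq_coordinates (hu.differentiableAt_momentum hf hp)] at hP
  obtain ⟨x, y, z⟩ := v
  simp only [jac2, Matrix.det_fin_two_of] at h hz hT hM hP
  subst hz
  by_cases hTM : lineDeriv ℝ (period u) p dirA * lineDeriv ℝ (mass u) p dirE -
      lineDeriv ℝ (period u) p dirE * lineDeriv ℝ (mass u) p dirA = 0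
  · have hTP := fun h' => h ⟨hTM, h'⟩
    refine Prod.ext ((mul_eq_zero.1 ?_).resolve_right hTP)
      (Prod.ext ((mul_eq_zero.1 ?_).resolve_right hTP) rfl)
    · linear_combination lineDeriv ℝ (momentum u) p dirE * hT - lineDeriv ℝ (period u) p dirE * hP
    · linear_combination lineDeriv ℝ (period u) p dirA * hP - lineDeriv ℝ (momentum u) p dirA * hT
  · refine Prod.ext ((mul_eq_zero.1 ?_).resolve_right hTM)
      (Prod.ext ((mul_eq_zero.1 ?_).resolve_right hTM) rfl)
    · linear_combination lineDeriv ℝ (mass u) p dirE * hT - lineDeriv ℝ (period u) p dirE * hM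
    · linear_combination lineDeriv ℝ (period u) p dirA * hM - lineDeriv ℝ (mass u) p dirA * hT

theorem stationary_eq_zero_of_jac3 (hu : IsPeriodicWaveFamily f F Ω u) (hf : ContDiff ℝ 2 f)
    (hp : p ∈ Ω) (h : jac3 (period u) (mass u) (momentum u) dirE dirA dirC p ≠ 0)
    (v : Param) (hT : lineDeriv ℝ (period u) p v = 0)
    (hM : lineDeriv ℝ (mass u) p v = 0) (hP : lineDeriv ℝ (momentum u) p v = 0) : v = 0 := by
  rw [lineDeriv_eq_coordinates (hu.differentiableAt_period hf hp)] at hT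
  rw [lineDeriv_eq_coordinates (hu.differentiableAt_mass hf hp)] at hM
  rw [lineDeriv_eq_coordinates (hu.differentiableAt_momentum hf hp)] at hP
  obtain ⟨x, y, z⟩ := v
  have hdet : (!![lineDeriv ℝ (period u) p dirE, lineDeriv ℝ (period u) p dirA,
      lineDeriv ℝ (period u) p dirC;
      lineDeriv ℝ (mass u) p dirE, lineDeriv ℝ (mass u) p dirA, lineDeriv ℝ (mass u) p dirC;
      lineDeriv ℝ (momentum u) p dirE, lineDeriv ℝ (momentum u) p dirA,
      lineDeriv ℝ (momentum u) p dirC] : Matrix (Fin 3) (Fin 3) ℝ).det ≠ 0 := h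
  have h0 := Matrix.eq_zero_of_mulVec_eq_zero hdet (v := ![y, x, z]) (by
    ext i
    fin_cases i <;> simp [Matrix.mulVec, dotProduct, Fin.sum_univ_three]
    · linear_combination hT
    · linear_combination hM
    · linear_combination hP)
  have h1 := congrFun h0 0
  have h2 := congrFun h0 1
  have h3 := congrFun h0 2
  simp only [Matrix.cons_val_zero, Matrix.cons_val_one, Matrix.cons_val, Pi.zero_apply]
    at h1 h2 h3
  rw [h1, h2, h3]
  rfl

theorem jac3_swap (G H K : Param → ℝ) (v w z p : Param) :
    jac3 G H K v w z p = -jac3 G H K w v z p := by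
  simp only [jac3, Matrix.det_fin_three]
  simp
  ring

theorem gradCross_ne_zero (hu : IsPeriodicWaveFamily f F Ω u) (hf : ContDiff ℝ 2 f)
    (hF : ∀ y, HasDerivAt F (f y) y) (hp : p ∈ Ω)
    (h : ¬(jac2 (period u) (mass u) dirA dirE p = 0 ∧
      jac2 (period u) (momentum u) dirA dirE p = 0)) :
    (gradCross u p).1 ≠ 0 ∨ (gradCross u p).2.2 ≠ 0 := by
  by_contra! h0
  simp only [gradCross] at h0
  refine h ⟨?_, ?_⟩ <;> rw [jac2, Matrix.det_fin_two_of]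
  · linear_combination -h0.2
  · rw [hu.momentum_dirA hf hF hp, hu.momentum_dirE hf hF hp]
    rw [hu.mass_dirE hf hF hp] at h0
    linear_combination 2 * h0.1

/-- If `T_a` and `T_E` do not both vanish, the period is stationary in some direction transversal
to the `(a, E)`-plane. -/
theorem exists_stationary_transversal (hu : IsPeriodicWaveFamily f F Ω u) (hf : ContDiff ℝ 2 f)
    (hp : p ∈ Ω)
    (hnd : ¬(lineDeriv ℝ (period u) p dirE = 0 ∧ lineDeriv ℝ (period u) p dirA = 0)) :
    ∃ n : Param, lineDeriv ℝ (period u) p n = 0 ∧ n.2.2 ≠ 0 := by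
  have hT := lineDeriv_eq_coordinates (hu.differentiableAt_period hf hp)
  by_cases hE : lineDeriv ℝ (period u) p dirE = 0
  · have hA : lineDeriv ℝ (period u) p dirA ≠ 0 := fun h => hnd ⟨hE, h⟩
    refine ⟨(-lineDeriv ℝ (period u) p dirC / lineDeriv ℝ (period u) p dirA, 0, 1), ?_, by simp⟩
    rw [hT]
    field_simp
    ring
  · refine ⟨(0, -lineDeriv ℝ (period u) p dirC / lineDeriv ℝ (period u) p dirE, 1), ?_, by simp⟩
    rw [hT]
    field_simp
    ring

theorem finrank_gker_one (hu : IsPeriodicWaveFamily f F Ω u) (hf : ContDiff ℝ 2 f)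
    (hF : ∀ y, HasDerivAt F (f y) y) (hp : p ∈ Ω) (hk : 1 ≤ k)
    (h : ¬(jac2 (period u) (mass u) dirA dirE p = 0 ∧
      jac2 (period u) (momentum u) dirA dirE p = 0)) :
    Module.finrank ℝ (gker (opDL u f p k) 1) = 1 ∧
      Module.finrank ℝ (gker (opLD u f p k) 1) = 1 := by
  have hnd := period_nondegenerate h
  obtain ⟨n, hn, hn'⟩ := hu.exists_stationary_transversal hf hp hnd
  obtain ⟨h1, h2⟩ := hu.gkerSpannedBy_opDL hf hF hp hk (hu.stationary_eq_zero_of_jac2 hf hp h)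
    hn hn'
  obtain ⟨h3, h4⟩ := hu.gkerSpannedBy_opLD hf hF hp hk hnd (hu.gradCross_ne_zero hf hF hp h)
  exact ⟨finrank_gker_eq_one h1 h2, finrank_gker_eq_one h3 h4⟩

theorem gkerSpannedBy_phi2 (hu : IsPeriodicWaveFamily f F Ω u) (hf : ContDiff ℝ 2 f)
    (hF : ∀ y, HasDerivAt F (f y) y) (hp : p ∈ Ω) (hk : 1 ≤ k)
    (h : jac2 (period u) (mass u) dirA dirE p ≠ 0) :
    GkerSpannedBy (opDL u f p k) 1 (cls u p k (phi2 u p)) ∧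
      GkerSpannedBy (opLD u f p k) 1 (cls u p k (fun x => ∫ t in (0 : ℝ)..x, phi2 u p t)) := by
  have h' : ¬(jac2 (period u) (mass u) dirA dirE p = 0 ∧
      jac2 (period u) (momentum u) dirA dirE p = 0) := fun h0 => h h0.1
  have hz : (gradCross u p).2.2 ≠ 0 := by
    intro h0
    refine h ?_
    rw [jac2, Matrix.det_fin_two_of]
    simp only [gradCross] at h0
    linear_combination -h0
  rw [hu.phi2_eq hp, cls_uParam, cls_integral_uParam]
  exact ⟨(hu.gkerSpannedBy_opDL hf hF hp hk (hu.stationary_eq_zero_of_jac2 hf hp h')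
    (hu.period_gradCross hf hp) hz).1, (hu.gkerSpannedBy_opLD hf hF hp hk
      (period_nondegenerate h') (Or.inr hz)).1⟩

theorem subsingleton_gker_of_two_le (hu : IsPeriodicWaveFamily f F Ω u) (hf : ContDiff ℝ 2 f)
    (hF : ∀ y, HasDerivAt F (f y) y) (hp : p ∈ Ω) (hk : 1 ≤ k)
    (h : jac2 (period u) (mass u) dirA dirE p ≠ 0)
    (h' : jac3 (period u) (mass u) (momentum u) dirE dirA dirC p ≠ 0) {j : ℕ} (hj : 2 ≤ j) :
    Subsingleton (gker (opDL u f p k) j) ∧ Subsingleton (gker (opLD u f p k) j) :=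
  have hst := hu.stationary_eq_zero_of_jac3 hf hp h'
  ⟨subsingleton_gker (kerPow_succ_le_of_stable (hu.kerPow_opDL_stable hf hF hp hk hst) hj),
    subsingleton_gker (kerPow_succ_le_of_stable (hu.kerPow_opLD_stable hf hF hp hk
      (period_nondegenerate fun h0 => h h0.1) hst) hj)⟩

end IsPeriodicWaveFamily

end KdV

open KdV in
theorem mainTheorem3
    (f F : ℝ → ℝ) (hf : ContDiff ℝ 2 f) (hF : ∀ y, HasDerivAt F (f y) y)
    (Ω : Set Param) (u : Param → ℝ → ℝ) (hu : IsPeriodicWaveFamily f F Ω u)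
    (p : Param) (hp : p ∈ Ω) (k : ℕ) (hk : 1 ≤ k) :
    -- the derivatives of `T`, `M`, `P` at the given parameter point exist
    (DifferentiableAt ℝ (period u) p ∧ DifferentiableAt ℝ (mass u) p ∧
      DifferentiableAt ℝ (momentum u) p) ∧
    -- the generic dimensions
    (lineDeriv ℝ (period u) p dirE ≠ 0 →
      jac2 (period u) (mass u) dirA dirE p ≠ 0 →
      jac3 (period u) (mass u) (momentum u) dirA dirE dirC p ≠ 0 →
      Module.finrank ℝ (opKer (opL u f p k)) = 1 ∧
      Module.finrank ℝ (opKer (opDL u f p k)) = 2 ∧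
      Module.finrank ℝ (gker (opDL u f p k) 1) = 1 ∧
      ∀ j, 2 ≤ j → Subsingleton (gker (opDL u f p k) j)) ∧
    -- the kernel of `𝓛`
    (lineDeriv ℝ (period u) p dirE ≠ 0 →
      opKer (opL u f p k) = Submodule.span ℝ {cls u p k (deriv (u p))}) ∧
    (lineDeriv ℝ (period u) p dirE = 0 →
      opKer (opL u f p k) =
        Submodule.span ℝ {cls u p k (deriv (u p)), cls u p k (uParam u dirE p)}) ∧
    -- the kernels of `∂ₓ𝓛` and `𝓛∂ₓ`
    (¬(lineDeriv ℝ (period u) p dirE = 0 ∧ lineDeriv ℝ (period u) p dirA = 0) →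
      opKer (opDL u f p k) =
        Submodule.span ℝ {cls u p k (deriv (u p)), cls u p k (phi1 u p)} ∧
      opKer (opLD u f p k) =
        Submodule.span ℝ {cls u p k (fun _ => 1), cls u p k (u p)}) ∧
    (lineDeriv ℝ (period u) p dirE = 0 ∧ lineDeriv ℝ (period u) p dirA = 0 →
      opKer (opDL u f p k) =
        Submodule.span ℝ {cls u p k (deriv (u p)), cls u p k (uParam u dirA p),
          cls u p k (uParam u dirE p)} ∧
      opKer (opLD u f p k) =
        Submodule.span ℝ {cls u p k (fun _ => 1), cls u p k (u p),
          cls u p k (fun x => ∫ t in (0 : ℝ)..x, uParam u dirE p t)}) ∧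
    (Module.rank ℝ (opKer (opDL u f p k)) ≤ 3 ∧ Module.rank ℝ (opKer (opLD u f p k)) ≤ 3) ∧
    -- the first generalized kernels
    (jac2 (period u) (mass u) dirA dirE p ≠ 0 →
      GkerSpannedBy (opDL u f p k) 1 (cls u p k (phi2 u p)) ∧
      GkerSpannedBy (opLD u f p k) 1 (cls u p k (fun x => ∫ t in (0 : ℝ)..x, phi2 u p t))) ∧
    (¬(jac2 (period u) (mass u) dirA dirE p = 0 ∧
        jac2 (period u) (momentum u) dirA dirE p = 0) →
      Module.finrank ℝ (gker (opDL u f p k) 1) = 1 ∧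
      Module.finrank ℝ (gker (opLD u f p k) 1) = 1) ∧
    -- the higher generalized kernels
    (jac2 (period u) (mass u) dirA dirE p ≠ 0 →
      jac3 (period u) (mass u) (momentum u) dirE dirA dirC p ≠ 0 →
      ∀ j, 2 ≤ j →
        Subsingleton (gker (opDL u f p k) j) ∧ Subsingleton (gker (opLD u f p k) j)) := by
  refine ⟨⟨hu.differentiableAt_period hf hp, hu.differentiableAt_mass hf hp,
    hu.differentiableAt_momentum hf hp⟩, fun hE hTM hTMP => ?_,
    hu.opKer_opL_eq_span_of_ne hf hF hp hk, hu.opKer_opL_eq_span_of_eq hf hF hp hk,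
    fun h => ⟨hu.opKer_opDL_eq_span_of_not hf hF hp hk h,
      hu.opKer_opLD_eq_span_of_not hf hF hp hk h⟩,
    fun h => ⟨hu.opKer_opDL_eq_span_of_stationary hf hF hp hk h.1 h.2,
      hu.opKer_opLD_eq_span_of_stationary hf hF hp hk h.1 h.2⟩,
    hu.rank_opKer_le hf hF hp hk, hu.gkerSpannedBy_phi2 hf hF hp hk,
    hu.finrank_gker_one hf hF hp hk,
    fun hTM hTMP j hj => hu.subsingleton_gker_of_two_le hf hF hp hk hTM hTMP hj⟩
  rw [IsPeriodicWaveFamily.jac3_swap, neg_ne_zero] at hTMP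
  exact ⟨hu.finrank_opKer_opL hf hF hp hk hE, hu.finrank_opKer_opDL hf hF hp hk hE,
    (hu.finrank_gker_one hf hF hp hk fun h => hTM h.1).1,
    fun j hj => (hu.subsingleton_gker_of_two_le hf hF hp hk hTM hTMP hj).1⟩
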